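/- **Theorem (Existence and uniqueness of a solution on the network).** Let $(\mathcal V,\mathcal A)$ be a finite acyclic network: a connected directed graph with finite node set $\mathcal V\subset\mathbb N_{\ge1}$, links $\mathcal A\subseteq\mathcal V\times\mathcal V$ and no directed cycle. For $v\in\mathcal V$ let $\mathcal A_{\rm in}(v)$ and $\mathcal A_{\rm out}(v)$ be the sets of links that end, respectively originate, in $v$. Let $T>0$, $p\in[1,\infty)$, $b,d\in[0,1]$, and for every $a\in\mathcal A$ let $\lambda_a\in C^1([0,T]\times\mathbb R;\mathbb R_{>0})$ and $\rho_{a,0}\in L^\infty((0,1);\mathbb R_{\ge0})$. For $v\in\mathcal V$ and $a\in\mathcal A_{\rm out}(v)$ let the splits $\theta^v_a$ and the sources $s^v_a$ be elements of $L^\infty((0,T);\mathbb R_{\ge0})$ such that, for every $v$ with $\mathcal A_{\rm out}(v)\neq\emptyset$, $\sum_{\tilde a\in\mathcal A_{\rm out}(v)}\theta^v_{\tilde a}(t)=1$ for a.e. $t\in(0,T)$. A *weak solution on the network* consists of densities $\rho_a\in C([0,T];L^p((0,1)))\cap L^\infty((0,T);L^\infty((0,1)))$, inflows $u_a\in L^1((0,T))$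 and outflows $y_a\in L^1((0,T))$, $a\in\mathcal A$, such that 1. for every $a\in\mathcal A$, with $W_a(t):=\int_b^d\rho_a(t,z)\,dz$, the problem $$\partial_t\rho_a+\partial_x\big(\lambda_a(t,W_a(t))\,\rho_a\big)=0,\quad \rho_a(0,\cdot)=\rho_{a,0},\quad \lambda_a(t,W_a(t))\rho_a(t,0)=u_a(t),\quad \lambda_a(t,W_a(t))\rho_a(t,1)=y_a(t)$$ holds on $(0,T)\times(0,1)$ in the weak sense, that is, for every $\varphi\in C^1(\mathbb R^2)$ with $\varphi(T,\cdot)=0$ on $[0,1]$, $$\int_0^T\!\!\int_0^1\rho_a\big(\partial_t\varphi+\lambda_a(t,W_a(t))\,\partial_x\varphi\big)\,dx\,dt+\int_0^1\rho_{a,0}(x)\varphi(0,x)\,dx+\int_0^Tu_a(t)\varphi(t,0)\,dt-\int_0^Ty_a(t)\varphi(t,1)\,dt=0;$$ 2. flow is conserved at the nodes: for all $v\in\mathcal V$ and $a\in\mathcal A_{\rm out}(v)$, $$u_a(t)=s^v_a(t)+\theta^v_a(t)\sum_{\tilde a\in\mathcal A_{\rm in}(v)}y_{\tilde a}(t)\qquad\text{for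 a.e. }t\in(0,T).$$ Then there is a weak solution on the network with $\rho_a,u_a,y_a\ge0$ almost everywhere for all $a\in\mathcal A$, and it is unique among all weak solutions on the network (of whatever sign): any other one has the same $\rho_a(t,\cdot)$ in $L^p((0,1))$ for all $t\in[0,T]$, and the same $u_a$ and $y_a$ a.e. on $(0,T)$, for all $a\in\mathcal A$. -/

import Mathlib

open MeasureTheory Set
open scoped ENNReal

/-- A (finite) network: a connected directed graph whose nodes are positive integers and whose
links are ordered pairs of nodes.  The link `(v, w)` originates in `v` and ends in `w`;
connectedness means that any two nodes are joined by an undirected path. -/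
structure Network where
  nodes : Finset ℕ
  one_le_of_mem : ∀ v ∈ nodes, 1 ≤ v
  links : Finset (ℕ × ℕ)
  links_subset : links ⊆ nodes ×ˢ nodes
  connected : ∀ v ∈ nodes, ∀ w ∈ nodes, Relation.EqvGen (fun i j => (i, j) ∈ links) v w

namespace Network

/-- The links of the network, as a (finite) type. -/
abbrev Link (N : Network) : Type := {a : ℕ × ℕ // a ∈ N.links}

/-- The node in which a link originates. -/
def origin {N : Network} (a : N.Link) : ℕ := a.1.1

/-- The node in which a link ends. -/
def target {N : Network} (a : N.Link) : ℕ := a.1.2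

/-- The links ending in `v`. -/
def inLinks (N : Network) (v : ℕ) : Finset N.Link := Finset.univ.filter fun a => target a = v

/-- The links originating in `v`. -/
def outLinks (N : Network) (v : ℕ) : Finset N.Link := Finset.univ.filter fun a => origin a = v

/-- There is no directed cycle. -/
def Acyclic (N : Network) : Prop :=
  ∀ v, ¬ Relation.TransGen (fun i j => (i, j) ∈ N.links) v v

end Network

/-- `f ∈ L^∞(I; ℝ_{≥0})`. -/
def IsLinftyNonneg (I : Set ℝ) (f : ℝ → ℝ) : Prop :=
  MemLp f ∞ (volume.restrict I) ∧ ∀ᵐ x ∂volume.restrict I, 0 ≤ f x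

/-- The set `Θ` of splits.  A link `a` belongs to `outLinks v` for exactly one `v`, its origin, so
the split `θ_a^v` is indexed by the link alone.  The splits sum to one at every node from which at
least one link originates. -/
def IsSplit (N : Network) (T : ℝ) (θ : N.Link → ℝ → ℝ) : Prop :=
  (∀ a, IsLinftyNonneg (Ioo 0 T) (θ a)) ∧
  ∀ v ∈ N.nodes, (N.outLinks v).Nonempty →
    ∀ᵐ t ∂volume.restrict (Ioo 0 T), ∑ a ∈ N.outLinks v, θ a t = 1

/-- The set `S` of sources; `s_a^v` is indexed by the link `a` alone, as for the splits. -/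
def IsSource (N : Network) (T : ℝ) (s : N.Link → ℝ → ℝ) : Prop :=
  ∀ a, IsLinftyNonneg (Ioo 0 T) (s a)

/-- `lam ∈ C¹([0,T] × ℝ; ℝ_{>0})`. -/
def IsVelocity (T : ℝ) (lam : ℝ → ℝ → ℝ) : Prop :=
  ContDiffOn ℝ 1 (Function.uncurry lam) (Icc 0 T ×ˢ univ) ∧ ∀ t ∈ Icc 0 T, ∀ w, 0 < lam t w

/-- The space `L^p((0,1))`. -/
noncomputable abbrev LpUnit (p : ℝ≥0∞) := Lp ℝ p (volume.restrict (Ioo (0 : ℝ) 1))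

/-- `ρ ∈ C([0,T]; L^p((0,1))) ∩ L^∞((0,T); L^∞((0,1)))`. -/
def InSolutionSpace (T : ℝ) (p : ℝ≥0∞) [Fact (1 ≤ p)] (ρ : ℝ → LpUnit p) : Prop :=
  ContinuousOn ρ (Icc 0 T) ∧
  ∃ M : ℝ, ∀ᵐ t ∂volume.restrict (Ioo 0 T),
    ∀ᵐ x ∂volume.restrict (Ioo (0 : ℝ) 1), |ρ t x| ≤ M

/-- `ρ` is a weak solution, on one link, of
`∂_t ρ + ∂_x (lam(t, ∫_b^d ρ(t,y) dy) ρ) = 0` on `(0,T) × (0,1)` with initial datum `ρ₀`,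
flow `u` through `x = 0` and flow `y` through `x = 1`: the equation is multiplied by a test
function that vanishes at `t = T`, and integrated by parts.
(For `ρ ∈ C([0,T]; L^p)`, `lam` continuous and `ρ₀, u, y` integrable, all integrals exist.) -/
def IsLinkWeakSolution (T : ℝ) {p : ℝ≥0∞} (b d : ℝ) (lam : ℝ → ℝ → ℝ) (ρ₀ u y : ℝ → ℝ)
    (ρ : ℝ → LpUnit p) : Prop :=
  ∀ φ : ℝ → ℝ → ℝ, ContDiff ℝ 1 (Function.uncurry φ) → (∀ x ∈ Icc (0 : ℝ) 1, φ T x = 0) →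
    (∫ t in Ioo 0 T, ∫ x in Ioo (0 : ℝ) 1,
        ρ t x * (deriv (fun τ => φ τ x) t +
          lam t (∫ z in b..d, ρ t z) * deriv (fun ξ => φ t ξ) x))
      + (∫ x in Ioo (0 : ℝ) 1, ρ₀ x * φ 0 x)
      + (∫ t in Ioo 0 T, u t * φ t 0)
      - (∫ t in Ioo 0 T, y t * φ t 1) = 0

/-- Weak solutions of the model on the whole network: densities `ρ a`, inflows `u a` and
outflows `y a` such that, on every link, `ρ a` is a weak solution with these boundary flows, in the
class `C([0,T]; L^p) ∩ L^∞`, and such that flow is conserved at the nodes. -/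
structure IsNetworkWeakSolution (N : Network) (T : ℝ) (p : ℝ≥0∞) [Fact (1 ≤ p)] (b d : ℝ)
    (lam : N.Link → ℝ → ℝ → ℝ) (ρ₀ θ s : N.Link → ℝ → ℝ)
    (ρ : N.Link → ℝ → LpUnit p) (u y : N.Link → ℝ → ℝ) : Prop where
  mem_space : ∀ a, InSolutionSpace T p (ρ a)
  inflow_integrable : ∀ a, IntegrableOn (u a) (Ioo 0 T)
  outflow_integrable : ∀ a, IntegrableOn (y a) (Ioo 0 T)
  weak : ∀ a, IsLinkWeakSolution T b d (lam a) (ρ₀ a) (u a) (y a) (ρ a)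
  node : ∀ v ∈ N.nodes, ∀ a ∈ N.outLinks v, ∀ᵐ t ∂volume.restrict (Ioo 0 T),
    s a t + θ a t * ∑ a' ∈ N.inLinks v, y a' t = u a t

/-! The nonlocal speed depends on time only, `c t = lam t (W t)`. Once `c` is frozen, the equation
on a link is therefore linear transport with primitive `ξ` of `c`, and its solution is a travelling
profile `g (x - ξ t)`: the initial density for positive argument, and for negative argument the
inflow divided by the speed at its time of entry. Fubini along characteristics
(`linear_weak_identity`) shows that this is a weak solution, with outflow `c t * g (1 - ξ t)`.

The mass between `b` and `d` is a difference of values of a primitive of `g`. It is bounded by the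
total mass of the data, whatever the flow, and it is Lipschitz in `ξ`
(`abs_cumulative_sub_cumulative_le`). Only values of `lam` on a compact set matter, and a
contraction in an exponentially weighted norm yields exactly one speed consistent with the mass it
produces (`exists_unique_selfConsistent_flow`).

For uniqueness, a competitor of any sign has a continuous mass and hence a continuous positive speed
`c'`. Duality (`IsTransportSolution.unique`) identifies it with the travelling profile of `c'`. Thus
`c'` is self-consistent and equals `c` on `[0,T]`; duality once more, now with speed `c`, gives
equality of densities and outflows.

On the network, acyclicity makes "upstream of" well-founded on links. Outflows are again bounded and
nonnegative, so both existence and uniqueness pass from link to link by well-founded induction. -/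

/-! ### Bounded data extended by zero -/

/-- A bounded, measurable, nonnegative function that vanishes outside `I`. -/
structure IsBoundedDatum (I : Set ℝ) (K : ℝ) (f : ℝ → ℝ) : Prop where
  measurable : Measurable f
  nonneg : ∀ x, 0 ≤ f x
  le : ∀ x, f x ≤ K
  eq_zero : ∀ x, x ∉ I → f x = 0

namespace IsBoundedDatum

variable {I : Set ℝ} {K : ℝ} {f : ℝ → ℝ}

theorem bound_nonneg (h : IsBoundedDatum I K f) : 0 ≤ K := (h.nonneg 0).trans (h.le 0)

theorem abs_le (h : IsBoundedDatum I K f) (x : ℝ) : |f x| ≤ K := by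
  rw [abs_of_nonneg (h.nonneg x)]; exact h.le x

theorem eq_indicator (h : IsBoundedDatum I K f) : I.indicator f = f := by
  ext x
  by_cases hx : x ∈ I
  · simp [hx]
  · simp [hx, h.eq_zero x hx]

theorem integrable {a b : ℝ} (h : IsBoundedDatum (Ioo a b) K f) : Integrable f := by
  rw [← h.eq_indicator, integrable_indicator_iff measurableSet_Ioo]
  exact Measure.integrableOn_of_bounded (M := K) (by simp) h.measurable.aestronglyMeasurable
    (Filter.Eventually.of_forall h.abs_le)

end IsBoundedDatum

/-- Every nonnegative `L^∞` function has a bounded measurable extension by zero. -/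
theorem IsLinftyNonneg.exists_isBoundedDatum {I : Set ℝ} (hI : MeasurableSet I) {f : ℝ → ℝ}
    (h : IsLinftyNonneg I f) :
    ∃ K g, IsBoundedDatum I K g ∧ g =ᵐ[volume.restrict I] f := by
  obtain ⟨K, hK⟩ : ∃ K : ℝ, ∀ᵐ x ∂volume.restrict I, ‖f x‖ ≤ K := by
    have h1 := h.1.2
    rw [eLpNorm_exponent_top] at h1
    refine ⟨(eLpNormEssSup f (volume.restrict I)).toReal, ?_⟩
    filter_upwards [ae_le_eLpNormEssSup (f := f) (μ := volume.restrict I)] with x hx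
    have := (ENNReal.toReal_le_toReal (by simp) h1.ne).2 hx
    simpa using this
  let m := h.1.1.mk f
  have hm : Measurable m := h.1.1.stronglyMeasurable_mk.measurable
  -- Clipping a measurable representative to `[0, max K 0]` makes the bounds hold at every point; on
  -- `I` this changes it only on a null set.
  refine ⟨max K 0, I.indicator fun x => max 0 (min (max K 0) (m x)), ⟨?_, ?_, ?_, ?_⟩, ?_⟩
  · exact (measurable_const.max (measurable_const.min hm)).indicator hI
  · intro x; exact indicator_nonneg (fun x _ => le_max_left _ _) x
  · intro x
    refine indicator_apply_le' (fun _ => ?_) fun _ => le_max_right _ _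
    exact max_le (le_max_right _ _) (min_le_left _ _)
  · intro x hx; simp [hx]
  · filter_upwards [hK, h.2, h.1.1.ae_eq_mk, ae_restrict_mem hI] with x h1 h2 h3 h4
    rw [indicator_of_mem h4]
    change max 0 (min (max K 0) (h.1.1.mk f x)) = f x
    rw [← h3, min_eq_right, max_eq_right h2]
    exact ((le_abs_self _).trans h1).trans (le_max_left _ _)

/-! ### Flows of a positive, time-dependent speed -/

/-- `ξ` is the primitive of the speed `c ≥ m > 0` that vanishes at zero, and `τ` is its inverse. -/
structure IsFlow (m : ℝ) (c ξ τ : ℝ → ℝ) : Prop where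
  speed_continuous : Continuous c
  lower_pos : 0 < m
  le_speed : ∀ t, m ≤ c t
  hasDerivAt : ∀ t, HasDerivAt ξ (c t) t
  map_zero : ξ 0 = 0
  left_inv : ∀ t, τ (ξ t) = t
  right_inv : ∀ r, ξ (τ r) = r

theorem exists_isFlow {m : ℝ} {c : ℝ → ℝ} (hc : Continuous c) (hm : 0 < m) (hmc : ∀ t, m ≤ c t) :
    ∃ ξ τ, IsFlow m c ξ τ := by
  have hd : ∀ t, HasDerivAt (fun t => ∫ s in (0 : ℝ)..t, c s) (c t) t := fun t =>
    intervalIntegral.integral_hasDerivAt_right (hc.intervalIntegrable _ _)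
      (hc.stronglyMeasurableAtFilter _ _) hc.continuousAt
  set ξ : ℝ → ℝ := fun t => ∫ s in (0 : ℝ)..t, c s with hξ
  have hcont : Continuous ξ := continuous_iff_continuousAt.2 fun t => (hd t).continuousAt
  have h0 : ξ 0 = 0 := by simp [hξ]
  have hmono : StrictMono ξ := strictMono_of_deriv_pos fun t => by
    rw [(hd t).deriv]; exact hm.trans_le (hmc t)
  -- Growth at least linear with slope `m` makes `ξ` unbounded in both directions, so it is onto and
  -- has a global inverse.
  have hgrow : ∀ s t, s ≤ t → m * (t - s) ≤ ξ t - ξ s := fun s t hst =>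
    Convex.mul_sub_le_image_sub_of_le_deriv (D := univ) convex_univ hcont.continuousOn
      (fun t _ => (hd t).differentiableAt.differentiableWithinAt)
      (fun t _ => by rw [(hd t).deriv]; exact hmc t) s (mem_univ _) t (mem_univ _) hst
  have hsurj : Function.Surjective ξ := by
    refine hcont.surjective ?_ ?_
    · refine Filter.tendsto_atTop_mono' _ ?_ (Filter.tendsto_id.const_mul_atTop hm)
      filter_upwards [Filter.eventually_ge_atTop 0] with t ht
      have := hgrow 0 t ht
      simp only [h0, sub_zero] at this
      exact this
    · refine Filter.tendsto_atBot_mono' _ ?_ (Filter.tendsto_id.const_mul_atBot hm)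
      filter_upwards [Filter.eventually_le_atBot 0] with t ht
      have := hgrow t 0 ht
      simp only [h0, zero_sub] at this
      simp only [id]
      linarith
  refine ⟨ξ, Function.surjInv hsurj, hc, hm, hmc, hd, h0, fun t => ?_, fun r => ?_⟩
  · exact hmono.injective (Function.surjInv_eq hsurj _)
  · exact Function.surjInv_eq hsurj r

namespace IsFlow

variable {m : ℝ} {c ξ τ : ℝ → ℝ}

theorem speed_pos (h : IsFlow m c ξ τ) (t : ℝ) : 0 < c t := h.lower_pos.trans_le (h.le_speed t)

theorem continuous (h : IsFlow m c ξ τ) : Continuous ξ :=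
  continuous_iff_continuousAt.2 fun t => (h.hasDerivAt t).continuousAt

theorem strictMono (h : IsFlow m c ξ τ) : StrictMono ξ :=
  strictMono_of_deriv_pos fun t => by rw [(h.hasDerivAt t).deriv]; exact h.speed_pos t

theorem contDiff (h : IsFlow m c ξ τ) : ContDiff ℝ 1 ξ := by
  rw [contDiff_one_iff_deriv]
  refine ⟨fun t => (h.hasDerivAt t).differentiableAt, ?_⟩
  rw [show deriv ξ = c from funext fun t => (h.hasDerivAt t).deriv]
  exact h.speed_continuous

theorem lt_inv_iff (h : IsFlow m c ξ τ) {t r : ℝ} : t < τ r ↔ ξ t < r := by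
  rw [← h.strictMono.lt_iff_lt, h.right_inv]

theorem inv_lt_iff (h : IsFlow m c ξ τ) {t r : ℝ} : τ r < t ↔ r < ξ t := by
  rw [← h.strictMono.lt_iff_lt, h.right_inv]

theorem inv_strictMono (h : IsFlow m c ξ τ) : StrictMono τ := fun r s hrs => by
  rwa [h.inv_lt_iff, h.right_inv]

theorem inv_zero (h : IsFlow m c ξ τ) : τ 0 = 0 := by
  have := h.left_inv 0
  rwa [h.map_zero] at this

theorem inv_continuous (h : IsFlow m c ξ τ) : Continuous τ :=
  h.inv_strictMono.monotone.continuous_of_surjective fun t => ⟨ξ t, h.left_inv t⟩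

theorem inv_hasDerivAt (h : IsFlow m c ξ τ) (r : ℝ) : HasDerivAt τ (c (τ r))⁻¹ r :=
  HasDerivAt.of_local_left_inverse h.inv_continuous.continuousAt (h.hasDerivAt _)
    (h.speed_pos _).ne' (Filter.Eventually.of_forall h.right_inv)

theorem mul_sub_le (h : IsFlow m c ξ τ) {s t : ℝ} (hst : s ≤ t) : m * (t - s) ≤ ξ t - ξ s :=
  Convex.mul_sub_le_image_sub_of_le_deriv (D := univ) convex_univ h.continuous.continuousOn
    (fun t _ => (h.hasDerivAt t).differentiableAt.differentiableWithinAt)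
    (fun t _ => by rw [(h.hasDerivAt t).deriv]; exact h.le_speed t) s (mem_univ _) t (mem_univ _)
    hst

/-- Change of variables `t = τ r`. -/
theorem integral_inv (h : IsFlow m c ξ τ) (f : ℝ → ℝ) :
    ∫ r, f (τ r) / c (τ r) = ∫ t, f t := by
  have := integral_image_eq_integral_abs_deriv_smul MeasurableSet.univ
    (fun r _ => (h.inv_hasDerivAt r).hasDerivWithinAt) h.inv_strictMono.injective.injOn f
  rw [image_univ, (show Function.Surjective τ from fun t => ⟨ξ t, h.left_inv t⟩).range_eq,
    Measure.restrict_univ] at this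
  rw [this]
  refine integral_congr_ae (Filter.Eventually.of_forall fun r => ?_)
  simp only [smul_eq_mul, abs_of_pos (inv_pos.2 (h.speed_pos (τ r)))]
  rw [div_eq_inv_mul]

theorem integrable_inv (h : IsFlow m c ξ τ) {f : ℝ → ℝ} (hf : Integrable f) :
    Integrable fun r => f (τ r) / c (τ r) := by
  have := (integrableOn_image_iff_integrableOn_abs_deriv_smul MeasurableSet.univ
    (fun r _ => (h.inv_hasDerivAt r).hasDerivWithinAt) h.inv_strictMono.injective.injOn f).1
    (by rw [image_univ,
          (show Function.Surjective τ from fun t => ⟨ξ t, h.left_inv t⟩).range_eq]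
        exact hf.integrableOn)
  rw [integrableOn_univ] at this
  refine this.congr (Filter.Eventually.of_forall fun r => ?_)
  simp only [smul_eq_mul, abs_of_pos (inv_pos.2 (h.speed_pos (τ r)))]
  rw [div_eq_inv_mul]

end IsFlow

theorem IsBoundedDatum.integrable_mul {a b K : ℝ} {f k : ℝ → ℝ}
    (hf : IsBoundedDatum (Ioo a b) K f) (hk : Continuous k) : Integrable fun x => f x * k x := by
  have h1 : IntegrableOn (fun x => f x * k x) (Icc a b) :=
    hf.integrable.integrableOn.mul_continuousOn hk.continuousOn isCompact_Icc
  rw [← integrable_indicator_iff measurableSet_Icc] at h1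
  refine h1.congr (Filter.Eventually.of_forall fun x => ?_)
  by_cases hx : x ∈ Icc a b
  · simp [hx]
  · have : f x = 0 := hf.eq_zero x fun h => hx (Ioo_subset_Icc_self h)
    simp [this]

theorem IsFlow.intervalIntegral_inv {m : ℝ} {c ξ τ : ℝ → ℝ} (h : IsFlow m c ξ τ) (f : ℝ → ℝ)
    (a b : ℝ) : ∫ r in a..b, f (τ r) / c (τ r) = ∫ t in τ a..τ b, f t := by
  have key : ∀ a b, a ≤ b → ∫ r in a..b, f (τ r) / c (τ r) = ∫ t in τ a..τ b, f t := by
    intro a b hab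
    rw [intervalIntegral.integral_of_le hab,
      intervalIntegral.integral_of_le (h.inv_strictMono.monotone hab),
      ← integral_indicator measurableSet_Ioc, ← integral_indicator measurableSet_Ioc,
      ← h.integral_inv ((Ioc (τ a) (τ b)).indicator f)]
    refine integral_congr_ae (Filter.Eventually.of_forall fun r => ?_)
    have hiff : τ r ∈ Ioc (τ a) (τ b) ↔ r ∈ Ioc a b :=
      and_congr h.inv_strictMono.lt_iff_lt h.inv_strictMono.le_iff_le
    by_cases hr : r ∈ Ioc a b
    · simp [indicator_of_mem hr, indicator_of_mem (hiff.2 hr)]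
    · simp [indicator_of_notMem hr, indicator_of_notMem (mt hiff.1 hr)]
  rcases le_total a b with hab | hab
  · exact key a b hab
  · rw [intervalIntegral.integral_symm, key b a hab, ← intervalIntegral.integral_symm]

/-! ### The transported profile and its primitive -/

/-- The profile that is transported: the initial density to the right of the origin, and the
density that enters at time `τ (-z)` to its left. -/
noncomputable def profile (c τ r v : ℝ → ℝ) (z : ℝ) : ℝ := r z + v (τ (-z)) / c (τ (-z))

/-- A primitive of the profile. -/
noncomputable def cumulative (τ r v : ℝ → ℝ) (z : ℝ) : ℝ :=
  (∫ x in (0 : ℝ)..z, r x) - ∫ t in (0 : ℝ)..τ (-z), v t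

section Profile

variable {m T K₁ K₂ : ℝ} {c ξ τ r v : ℝ → ℝ}

/-- What enters during `(0,T)` sits at arguments between `-ξ T` and `0`, the initial density between
`0` and `1`; dividing the inflow by a speed at least `m` costs the factor `1 / m`. -/
theorem isBoundedDatum_profile (h : IsFlow m c ξ τ) (hT : 0 < T)
    (hr : IsBoundedDatum (Ioo 0 1) K₁ r) (hv : IsBoundedDatum (Ioo 0 T) K₂ v) :
    IsBoundedDatum (Ioo (-ξ T) 1) (K₁ + K₂ / m) (profile c τ r v) := by
  have hξT : 0 < ξ T := by rw [← h.map_zero]; exact h.strictMono hT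
  refine ⟨?_, fun z => ?_, fun z => ?_, fun z hz => ?_⟩
  · have h1 : Measurable fun z => τ (-z) := (h.inv_continuous.comp continuous_neg).measurable
    exact hr.measurable.add
      ((hv.measurable.comp h1).div (h.speed_continuous.measurable.comp h1))
  · exact add_nonneg (hr.nonneg z) (div_nonneg (hv.nonneg _) (h.speed_pos _).le)
  · exact add_le_add (hr.le z) (div_le_div₀ hv.bound_nonneg (hv.le _) h.lower_pos (h.le_speed _))
  · have h1 : r z = 0 := hr.eq_zero z fun hz' => hz ⟨by linarith [hz'.1], hz'.2⟩
    have h2 : v (τ (-z)) = 0 := hv.eq_zero _ fun hz' => hz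
      ⟨by linarith [h.inv_lt_iff.1 hz'.2],
        by have := h.lt_inv_iff.1 hz'.1
           rw [h.map_zero] at this
           linarith⟩
    simp [profile, h1, h2]

/-- The substitution `t = τ (-z)` absorbs the division by the speed. Mass is thus expressed through
the flow alone, without `c`, which is why stability in `ξ` suffices later. -/
theorem integral_profile (h : IsFlow m c ξ τ)
    (hr : IsBoundedDatum (Ioo 0 1) K₁ r) (hv : IsBoundedDatum (Ioo 0 T) K₂ v) (x₁ x₂ : ℝ) :
    ∫ z in x₁..x₂, profile c τ r v z = cumulative τ r v x₂ - cumulative τ r v x₁ := by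
  have hri := fun a b => hr.integrable.intervalIntegrable (a := a) (b := b)
  have hvi := fun a b => hv.integrable.intervalIntegrable (a := a) (b := b)
  have h1 : ∫ z in x₁..x₂, v (τ (-z)) / c (τ (-z)) = ∫ t in τ (-x₂)..τ (-x₁), v t := by
    rw [intervalIntegral.integral_comp_neg (f := fun z => v (τ z) / c (τ z)),
      h.intervalIntegral_inv]
  unfold profile cumulative
  rw [intervalIntegral.integral_add (hri _ _)
      (h.integrable_inv hv.integrable).comp_neg.intervalIntegrable, h1,
    ← intervalIntegral.integral_interval_sub_left (hri 0 x₂) (hri 0 x₁),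
    ← intervalIntegral.integral_interval_sub_left (hvi 0 _) (hvi 0 _)]
  ring

/-- The a priori bound that permits truncating the velocity: it does not depend on `τ`, since no
interval can hold more than all the data. -/
theorem abs_cumulative_sub_le
    (hr : IsBoundedDatum (Ioo 0 1) K₁ r) (hv : IsBoundedDatum (Ioo 0 T) K₂ v) (x₁ x₂ : ℝ) :
    |cumulative τ r v x₂ - cumulative τ r v x₁| ≤ (∫ x, r x) + ∫ t, v t := by
  have key : ∀ {I : Set ℝ} {K : ℝ} {f : ℝ → ℝ}, IsBoundedDatum I K f → Integrable f →
      ∀ a b, |(∫ x in (0 : ℝ)..b, f x) - ∫ x in (0 : ℝ)..a, f x| ≤ ∫ x, f x := by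
    intro I K f hf hi a b
    rw [intervalIntegral.integral_interval_sub_left hi.intervalIntegrable hi.intervalIntegrable,
      ← Real.norm_eq_abs]
    refine intervalIntegral.norm_integral_le_integral_norm_uIoc.trans ?_
    simp only [Real.norm_eq_abs, abs_of_nonneg (hf.nonneg _)]
    exact setIntegral_le_integral hi (Filter.Eventually.of_forall hf.nonneg)
  have h1 := key hr hr.integrable x₁ x₂
  have h2 := key hv hv.integrable (τ (-x₂)) (τ (-x₁))
  unfold cumulative
  rw [abs_le] at *
  constructor <;> linarith [h1.1, h1.2, h2.1, h2.2]

end Profile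

/-! ### The weak form along characteristics -/

section LinearWeak

variable {m T K₁ K₂ : ℝ} {c ξ τ r v : ℝ → ℝ}

theorem ContDiff.continuous_partial {φ : ℝ → ℝ → ℝ} (hφ : ContDiff ℝ 1 (Function.uncurry φ)) :
    (∀ t x, HasFDerivAt (Function.uncurry φ) (ContinuousLinearMap.coprod
        (ContinuousLinearMap.toSpanSingleton ℝ (deriv (fun τ => φ τ x) t))
        (ContinuousLinearMap.toSpanSingleton ℝ (deriv (fun ξ => φ t ξ) x))) (t, x)) ∧
    (Continuous fun q : ℝ × ℝ => deriv (fun τ => φ τ q.2) q.1) ∧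
    Continuous fun q : ℝ × ℝ => deriv (fun ξ => φ q.1 ξ) q.2 := by
  have hd : ∀ q : ℝ × ℝ, HasFDerivAt (Function.uncurry φ) (fderiv ℝ (Function.uncurry φ) q) q :=
    fun q => (hφ.differentiable one_ne_zero q).hasFDerivAt
  have h1 : ∀ t x, deriv (fun τ => φ τ x) t = fderiv ℝ (Function.uncurry φ) (t, x) (1, 0) := by
    intro t x
    exact ((hd (t, x)).comp_hasDerivAt t
      ((hasDerivAt_id t).prodMk (hasDerivAt_const t x))).deriv
  have h2 : ∀ t x, deriv (fun ξ => φ t ξ) x = fderiv ℝ (Function.uncurry φ) (t, x) (0, 1) := by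
    intro t x
    exact ((hd (t, x)).comp_hasDerivAt x
      ((hasDerivAt_const x t).prodMk (hasDerivAt_id x))).deriv
  refine ⟨fun t x => ?_, ?_, ?_⟩
  · convert hd (t, x) using 1
    ext <;> simp [h1, h2]
  · simp only [h1]
    exact (hφ.continuous_fderiv one_ne_zero).clm_apply continuous_const
  · simp only [h2]
    exact (hφ.continuous_fderiv one_ne_zero).clm_apply continuous_const

/-- The derivative of a test function along the flow. -/
theorem IsFlow.hasDerivAt_comp (h : IsFlow m c ξ τ) {φ : ℝ → ℝ → ℝ}
    (hφ : ContDiff ℝ 1 (Function.uncurry φ)) (z t : ℝ) :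
    HasDerivAt (fun t => φ t (z + ξ t))
      (deriv (fun τ => φ τ (z + ξ t)) t + c t * deriv (fun x => φ t x) (z + ξ t)) t := by
  have := (hφ.continuous_partial.1 t (z + ξ t)).comp_hasDerivAt t
    ((hasDerivAt_id t).prodMk ((h.hasDerivAt t).const_add z))
  refine HasDerivAt.congr_deriv (f' := _) this ?_
  simp

/-- The integral along one characteristic of the derivative of a test function. -/
theorem profile_mul_integral_characteristic (h : IsFlow m c ξ τ) (hT : 0 < T)
    (hr : IsBoundedDatum (Ioo 0 1) K₁ r) (hv : IsBoundedDatum (Ioo 0 T) K₂ v)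
    {φ : ℝ → ℝ → ℝ} (hφ : ContDiff ℝ 1 (Function.uncurry φ)) (hφT : ∀ x ∈ Icc (0 : ℝ) 1, φ T x = 0)
    (z : ℝ) :
    profile c τ r v z * ∫ t in {t | t ∈ Ioo 0 T ∧ z + ξ t ∈ Ioo (0 : ℝ) 1},
        (deriv (fun τ => φ τ (z + ξ t)) t + c t * deriv (fun x => φ t x) (z + ξ t)) =
      (Ioo 0 T).indicator (fun t => profile c τ r v (1 - ξ t) * φ t 1) (τ (1 - z))
        - r z * φ 0 z - v (τ (-z)) * φ (τ (-z)) 0 / c (τ (-z)) := by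
  by_cases hz : z ∈ Ioo (-ξ T) 1
  swap
  · have h0 := (isBoundedDatum_profile h hT hr hv).eq_zero z hz
    have h1 : r z = 0 := by
      by_contra h1
      have h2 : 0 < r z := lt_of_le_of_ne (hr.nonneg z) (Ne.symm h1)
      have := div_nonneg (hv.nonneg (τ (-z))) (h.speed_pos (τ (-z))).le
      simp only [profile] at h0
      linarith
    have h2 : v (τ (-z)) = 0 := by
      rw [profile, h1, zero_add, div_eq_zero_iff] at h0
      exact h0.resolve_right (h.speed_pos _).ne'
    have h3 : (Ioo 0 T).indicator (fun t => profile c τ r v (1 - ξ t) * φ t 1) (τ (1 - z)) = 0 := by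
      refine indicator_apply_eq_zero.2 fun _ => ?_
      simp [h.right_inv, h0]
    simp [h0, h1, h2, h3]
  have hz1 : 0 < τ (1 - z) := by
    rw [h.lt_inv_iff, h.map_zero]; linarith [hz.2]
  have hz2 : τ (-z) < T := by
    rw [h.inv_lt_iff]; linarith [hz.1]
  -- The characteristic with label `z` is inside the domain between its entry time `max 0 (τ (-z))`
  -- and its exit time `min T (τ (1 - z))`.
  have hset : {t | t ∈ Ioo 0 T ∧ z + ξ t ∈ Ioo (0 : ℝ) 1} =
      Ioo (max 0 (τ (-z))) (min T (τ (1 - z))) := by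
    ext t
    simp only [mem_ofPred_eq, mem_Ioo, max_lt_iff, lt_min_iff, h.inv_lt_iff, h.lt_inv_iff]
    constructor
    · rintro ⟨⟨h1, h2⟩, h3, h4⟩; refine ⟨⟨h1, ?_⟩, h2, ?_⟩ <;> linarith
    · rintro ⟨⟨h1, h2⟩, h3, h4⟩; refine ⟨⟨h1, h3⟩, ?_, ?_⟩ <;> linarith
  have hle : max 0 (τ (-z)) ≤ min T (τ (1 - z)) := by
    refine max_le (le_min hT.le hz1.le) (le_min hz2.le (h.inv_strictMono ?_).le)
    linarith
  have hcont : Continuous fun t =>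
      deriv (fun τ => φ τ (z + ξ t)) t + c t * deriv (fun x => φ t x) (z + ξ t) := by
    have hp : Continuous fun t => (t, z + ξ t) :=
      continuous_id.prodMk (continuous_const.add h.continuous)
    exact (hφ.continuous_partial.2.1.comp hp).add
      (h.speed_continuous.mul (hφ.continuous_partial.2.2.comp hp))
  rw [hset, ← integral_Ioc_eq_integral_Ioo, ← intervalIntegral.integral_of_le hle,
    intervalIntegral.integral_eq_sub_of_hasDerivAt (fun t _ => h.hasDerivAt_comp hφ z t)
      (hcont.intervalIntegrable _ _), mul_sub, sub_sub]
  congr 1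
  -- Exit is either through `x = 1` before time `T`, or at time `T`, where the test function
  -- vanishes.
  · rcases lt_or_ge (τ (1 - z)) T with h1 | h1
    · rw [min_eq_right h1.le, indicator_of_mem (show τ (1 - z) ∈ Ioo 0 T from ⟨hz1, h1⟩), h.right_inv]
      simp
    · rw [min_eq_left h1, indicator_of_notMem (fun h' => absurd h'.2 (not_lt.2 h1)), hφT, mul_zero]
      have : ξ T ≤ 1 - z := by
        rw [← h.right_inv (1 - z)]; exact h.strictMono.monotone h1
      exact ⟨by linarith [hz.1], by linarith⟩
  -- Entry is through `x = 0` for `z < 0` and at time zero for `z > 0`. At the corner `z = 0` both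
  -- data vanish, being supported in open intervals.
  · rcases lt_trichotomy z 0 with h1 | h1 | h1
    · have h2 : 0 < τ (-z) := by rw [h.lt_inv_iff, h.map_zero]; linarith
      have h3 : r z = 0 := hr.eq_zero z fun h' => absurd h'.1 (not_lt.2 h1.le)
      rw [max_eq_right h2.le, h.right_inv, profile, h3]
      simp
      ring
    · subst h1
      have h3 : r 0 = 0 := hr.eq_zero 0 fun h' => lt_irrefl _ h'.1
      have h4 : v 0 = 0 := hv.eq_zero 0 fun h' => lt_irrefl _ h'.1
      simp [profile, h.inv_zero, h3, h4]
    · have h2 : τ (-z) < 0 := by rw [h.inv_lt_iff, h.map_zero]; linarith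
      have h4 : v (τ (-z)) = 0 := hv.eq_zero _ fun h' => absurd h'.1 (not_lt.2 h2.le)
      rw [max_eq_left h2.le, profile, h4, h.map_zero]
      simp

end LinearWeak

section LinearWeak

variable {m T K₁ K₂ : ℝ} {c ξ τ r v : ℝ → ℝ}

theorem setIntegral_setIntegral_eq_indicator (s t : Set ℝ) (hs : MeasurableSet s)
    (ht : MeasurableSet t) (F : ℝ × ℝ → ℝ) :
    ∫ x in s, ∫ y in t, F (x, y) = ∫ x, ∫ y, (s ×ˢ t).indicator F (x, y) := by
  rw [← integral_indicator hs]
  refine integral_congr_ae (Filter.Eventually.of_forall fun x => ?_)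
  by_cases hx : x ∈ s
  · simp only [indicator_of_mem hx]
    rw [← integral_indicator ht]
    refine integral_congr_ae (Filter.Eventually.of_forall fun y => ?_)
    by_cases hy : y ∈ t <;> simp [hx, hy, indicator]
  · simp [indicator, hx]

/-- The transported profile satisfies the weak form of `∂_t ρ + c(t) ∂_x ρ = 0`. -/
theorem linear_weak_identity (h : IsFlow m c ξ τ) (hT : 0 < T)
    (hr : IsBoundedDatum (Ioo 0 1) K₁ r) (hv : IsBoundedDatum (Ioo 0 T) K₂ v)
    {φ : ℝ → ℝ → ℝ} (hφ : ContDiff ℝ 1 (Function.uncurry φ))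
    (hφT : ∀ x ∈ Icc (0 : ℝ) 1, φ T x = 0) :
    (∫ t in Ioo 0 T, ∫ x in Ioo (0 : ℝ) 1, profile c τ r v (x - ξ t) *
        (deriv (fun τ => φ τ x) t + c t * deriv (fun ξ => φ t ξ) x))
      + (∫ x in Ioo (0 : ℝ) 1, r x * φ 0 x)
      + (∫ t in Ioo 0 T, v t * φ t 0)
      - (∫ t in Ioo 0 T, c t * profile c τ r v (1 - ξ t) * φ t 1) = 0 := by
  have hg := isBoundedDatum_profile h hT hr hv
  set g := profile c τ r v with hgdef
  obtain ⟨-, hφ1, hφ2⟩ := hφ.continuous_partial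
  set D : ℝ × ℝ → ℝ := fun q =>
    deriv (fun τ => φ τ q.2) q.1 + c q.1 * deriv (fun ξ => φ q.1 ξ) q.2 with hD
  have hDc : Continuous D := hφ1.add ((h.speed_continuous.comp continuous_fst).mul hφ2)
  set S : Set (ℝ × ℝ) := Ioo 0 T ×ˢ Ioo (0 : ℝ) 1 with hS
  have hSm : MeasurableSet S := measurableSet_Ioo.prod measurableSet_Ioo
  obtain ⟨C, hC⟩ : ∃ C, ∀ q ∈ S, |D q| ≤ C := by
    obtain ⟨C, hC⟩ := (isCompact_Icc.prod isCompact_Icc :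
      IsCompact (Icc 0 T ×ˢ Icc (0 : ℝ) 1)).exists_bound_of_continuousOn hDc.continuousOn
    exact ⟨C, fun q hq => hC q ⟨Ioo_subset_Icc_self hq.1, Ioo_subset_Icc_self hq.2⟩⟩
  have hC0 : 0 ≤ C := (abs_nonneg _).trans
    (hC (T / 2, 1 / 2) ⟨⟨by simp; linarith, by simp; linarith⟩, by norm_num, by norm_num⟩)
  -- In the moving coordinate `z = x - ξ t` the integrand is dominated by a product of a function of
  -- `t` and `g z`, which justifies Fubini.
  have hint : Integrable (Function.uncurry fun t z => g z * S.indicator D (t, z + ξ t))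
      (volume.prod volume) := by
    have hdom : Integrable (fun q : ℝ × ℝ => (Ioo 0 T).indicator (fun _ => C) q.1 * g q.2)
        (volume.prod volume) :=
      Integrable.mul_prod (by
        rw [integrable_indicator_iff measurableSet_Ioo]; exact integrableOn_const (by simp))
        hg.integrable
    refine hdom.mono' ?_ (Filter.Eventually.of_forall fun q => ?_)
    · refine Measurable.aestronglyMeasurable ?_
      exact (hg.measurable.comp measurable_snd).mul ((hDc.measurable.indicator hSm).comp
        (measurable_fst.prodMk (measurable_snd.add (h.continuous.measurable.comp measurable_fst))))
    · obtain ⟨t, z⟩ := q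
      simp only [Function.uncurry, Real.norm_eq_abs, abs_mul, abs_of_nonneg (hg.nonneg z)]
      rw [mul_comm]
      refine mul_le_mul_of_nonneg_right ?_ (hg.nonneg z)
      by_cases hq : (t, z + ξ t) ∈ S
      · rw [indicator_of_mem hq, indicator_of_mem hq.1]; exact hC _ hq
      · rw [indicator_of_notMem hq, abs_zero]
        exact indicator_nonneg (fun _ _ => hC0) _
  have hmain : ∫ t in Ioo 0 T, ∫ x in Ioo (0 : ℝ) 1, g (x - ξ t) *
        (deriv (fun τ => φ τ x) t + c t * deriv (fun ξ => φ t ξ) x) =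
      ∫ z, ((Ioo 0 T).indicator (fun t => g (1 - ξ t) * φ t 1) (τ (1 - z))
        - r z * φ 0 z - v (τ (-z)) * φ (τ (-z)) 0 / c (τ (-z))) := by
    calc _ = ∫ t, ∫ x, S.indicator (fun q : ℝ × ℝ => g (q.2 - ξ q.1) * D q) (t, x) :=
          setIntegral_setIntegral_eq_indicator _ _ measurableSet_Ioo measurableSet_Ioo
            (fun q : ℝ × ℝ => g (q.2 - ξ q.1) * D q)
      _ = ∫ t, ∫ z, g z * S.indicator D (t, z + ξ t) := by
          refine integral_congr_ae (Filter.Eventually.of_forall fun t => ?_)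
          simp only
          rw [← integral_add_right_eq_self _ (ξ t)]
          refine integral_congr_ae (Filter.Eventually.of_forall fun z => ?_)
          by_cases hq : (t, z + ξ t) ∈ S
          · simp [indicator_of_mem hq]
          · simp [indicator_of_notMem hq]
      _ = ∫ z, ∫ t, g z * S.indicator D (t, z + ξ t) := integral_integral_swap hint
      _ = _ := by
          refine integral_congr_ae (Filter.Eventually.of_forall fun z => ?_)
          simp only
          rw [← profile_mul_integral_characteristic h hT hr hv hφ hφT z, integral_const_mul,
            ← integral_indicator]
          · congr 2
          · exact (measurable_id.prodMk
              (h.continuous.measurable.const_add z)) hSm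
  have hφc : Continuous (Function.uncurry φ) := hφ.continuous
  have hφx : ∀ x, Continuous fun t => φ t x := fun x =>
    hφc.comp (continuous_id.prodMk continuous_const)
  have hφt : ∀ t, Continuous fun x => φ t x := fun t =>
    hφc.comp (continuous_const.prodMk continuous_id)
  -- Extension by zero lets the substitution `t = τ (1 - z)` be made over the whole line; the inflow
  -- term uses `t = τ (-z)` in the same way.
  set w : ℝ → ℝ := (Ioo 0 T).indicator fun t => g (1 - ξ t) with hw
  have hwd : IsBoundedDatum (Ioo 0 T) (K₁ + K₂ / m) w := by
    refine ⟨(hg.measurable.comp (h.continuous.measurable.const_sub 1)).indicator measurableSet_Ioo,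
      fun t => indicator_nonneg (fun _ _ => hg.nonneg _) t,
      fun t => indicator_apply_le' (fun _ => hg.le _) fun _ => hg.bound_nonneg,
      fun t ht => indicator_of_notMem ht _⟩
  have hout : ∀ t, w t * (c t * φ t 1) =
      c t * (Ioo 0 T).indicator (fun t => g (1 - ξ t) * φ t 1) t := fun t => by
    by_cases ht : t ∈ Ioo 0 T
    · simp [hw, ht]; ring
    · simp [hw, ht]
  have hout' : ∀ s, w (τ s) * (c (τ s) * φ (τ s) 1) / c (τ s) =
      (Ioo 0 T).indicator (fun t => g (1 - ξ t) * φ t 1) (τ s) := fun s => by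
    rw [hout, mul_div_cancel_left₀ _ (h.speed_pos _).ne']
  have h1i := hwd.integrable_mul (k := fun t => c t * φ t 1) (h.speed_continuous.mul (hφx 1))
  have h1i' := (h.integrable_inv h1i).comp_sub_left 1
  have h1 := h.integral_inv fun t => w t * (c t * φ t 1)
  rw [← integral_sub_left_eq_self _ _ (1 : ℝ)] at h1
  simp only [hout'] at h1 h1i'
  have h3i := hv.integrable_mul (hφx 0)
  have h3i' := (h.integrable_inv h3i).comp_neg
  have h3 := h.integral_inv fun t => v t * φ t 0
  rw [← integral_neg_eq_self] at h3
  have h2i := hr.integrable_mul (hφt 0)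
  have h12 : Integrable fun z =>
      (Ioo 0 T).indicator (fun t => g (1 - ξ t) * φ t 1) (τ (1 - z)) - r z * φ 0 z := h1i'.sub h2i
  rw [hmain, integral_sub h12 h3i', integral_sub h1i' h2i, h1, h3]
  rw [setIntegral_eq_integral_of_forall_compl_eq_zero (fun x hx => by
      rw [hr.eq_zero x hx, zero_mul]),
    setIntegral_eq_integral_of_forall_compl_eq_zero (fun x hx => by
      rw [hv.eq_zero x hx, zero_mul]), ← integral_indicator measurableSet_Ioo]
  have h4 : ∀ t, w t * (c t * φ t 1) =
      (Ioo 0 T).indicator (fun t => c t * g (1 - ξ t) * φ t 1) t := fun t => by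
    by_cases ht : t ∈ Ioo 0 T
    · simp [hw, ht]; ring
    · simp [hw, ht]
  simp only [h4]
  ring

end LinearWeak

/-! ### Pairings and translations in `L^p((0,1))` -/

section Pairing

open Filter Topology

instance isProbabilityMeasure_unitInterval :
    IsProbabilityMeasure (volume.restrict (Ioo (0 : ℝ) 1)) := ⟨by simp⟩

variable {p : ℝ≥0∞} [Fact (1 ≤ p)]

theorem LpUnit.integrable (f : LpUnit p) : Integrable f (volume.restrict (Ioo (0 : ℝ) 1)) :=
  (Lp.memLp f).integrable Fact.out

theorem LpUnit.integral_abs_le_norm (f : LpUnit p) : ∫ x in Ioo (0 : ℝ) 1, |f x| ≤ ‖f‖ := by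
  have h := eLpNorm_le_eLpNorm_of_exponent_le (Fact.out : 1 ≤ p) (Lp.aestronglyMeasurable f)
  rw [eLpNorm_one_eq_lintegral_enorm] at h
  have h' := ENNReal.toReal_mono (Lp.eLpNorm_ne_top f) h
  rwa [← integral_norm_eq_lintegral_enorm (Lp.aestronglyMeasurable f), ← Lp.norm_def] at h'

theorem LpUnit.integrable_mul (f : LpUnit p) {k : ℝ → ℝ} {C : ℝ} (hk : Measurable k)
    (hC : ∀ x ∈ Ioo (0 : ℝ) 1, |k x| ≤ C) :
    Integrable (fun x => f x * k x) (volume.restrict (Ioo (0 : ℝ) 1)) :=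
  (LpUnit.integrable f).mul_bdd hk.aestronglyMeasurable
    (by filter_upwards [ae_restrict_mem measurableSet_Ioo] with x hx using hC x hx)

/-- Pairing a continuous curve in `L^p` with a bounded family of functions that depends continuously
on time is continuous. -/
theorem continuousOn_integral_mul {S : Set ℝ} {ρ : ℝ → LpUnit p} (hρ : ContinuousOn ρ S)
    {ψ : ℝ → ℝ → ℝ} (hψ : ∀ t, Measurable (ψ t)) {C : ℝ}
    (hC : ∀ t ∈ S, ∀ x ∈ Ioo (0 : ℝ) 1, |ψ t x| ≤ C)
    (hcont : ∀ s ∈ S, ∀ x ∈ Ioo (0 : ℝ) 1, ContinuousWithinAt (fun t => ψ t x) S s) :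
    ContinuousOn (fun t => ∫ x in Ioo (0 : ℝ) 1, ρ t x * ψ t x) S := by
  intro s hs
  -- Split `ρ t * ψ t = (ρ t - ρ s) * ψ t + ρ s * ψ t`: dominated convergence handles the second
  -- term, norm continuity of the curve the first.
  have h1 : Tendsto (fun t => ∫ x in Ioo (0 : ℝ) 1, ρ s x * ψ t x) (𝓝[S] s)
      (𝓝 (∫ x in Ioo (0 : ℝ) 1, ρ s x * ψ s x)) := by
    refine tendsto_integral_filter_of_dominated_convergence (fun x => |ρ s x| * C) ?_ ?_ ?_ ?_
    · exact Eventually.of_forall fun t =>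
        (Lp.aestronglyMeasurable _).mul (hψ t).aestronglyMeasurable
    · filter_upwards [self_mem_nhdsWithin] with t ht
      filter_upwards [ae_restrict_mem measurableSet_Ioo] with x hx
      rw [Real.norm_eq_abs, abs_mul]
      exact mul_le_mul_of_nonneg_left (hC t ht x hx) (abs_nonneg _)
    · exact (LpUnit.integrable (ρ s)).abs.mul_const C
    · filter_upwards [ae_restrict_mem measurableSet_Ioo] with x hx
      exact (hcont s hs x hx).const_mul _
  have h2 : Tendsto (fun t => ∫ x in Ioo (0 : ℝ) 1, (ρ t - ρ s : LpUnit p) x * ψ t x)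
      (𝓝[S] s) (𝓝 0) := by
    have h3 : Tendsto (fun t => C * ‖ρ t - ρ s‖) (𝓝[S] s) (𝓝 0) := by
      have := ((hρ s hs).sub_const (ρ s)).norm.const_mul C
      simpa using this
    refine squeeze_zero_norm' ?_ h3
    filter_upwards [self_mem_nhdsWithin] with t ht
    have hC0 : 0 ≤ C := (abs_nonneg _).trans (hC t ht (1 / 2) (by norm_num))
    calc ‖∫ x in Ioo (0 : ℝ) 1, (ρ t - ρ s : LpUnit p) x * ψ t x‖
        ≤ ∫ x in Ioo (0 : ℝ) 1, C * |(ρ t - ρ s : LpUnit p) x| := by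
          refine norm_integral_le_of_norm_le ((LpUnit.integrable _).abs.const_mul C) ?_
          filter_upwards [ae_restrict_mem measurableSet_Ioo] with x hx
          rw [Real.norm_eq_abs, abs_mul, mul_comm]
          exact mul_le_mul_of_nonneg_right (hC t ht x hx) (abs_nonneg _)
      _ ≤ C * ‖ρ t - ρ s‖ := by
          rw [integral_const_mul]
          exact mul_le_mul_of_nonneg_left (LpUnit.integral_abs_le_norm _) hC0
  have h4 := h2.add h1
  rw [zero_add] at h4
  refine h4.congr' ?_
  filter_upwards [self_mem_nhdsWithin] with t ht
  rw [← integral_add (LpUnit.integrable_mul _ (hψ t) (hC t ht))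
    (LpUnit.integrable_mul _ (hψ t) (hC t ht))]
  refine integral_congr_ae ?_
  filter_upwards [Lp.coeFn_sub (ρ t) (ρ s)] with x hx
  rw [hx, Pi.sub_apply]
  ring

/-- The signed weight of the interval from `b` to `d`. -/
noncomputable def intervalWeight (b d : ℝ) : ℝ → ℝ :=
  fun x => (Ioc b d).indicator 1 x - (Ioc d b).indicator 1 x

theorem measurable_intervalWeight (b d : ℝ) : Measurable (intervalWeight b d) :=
  (measurable_one.indicator measurableSet_Ioc).sub (measurable_one.indicator measurableSet_Ioc)

theorem abs_intervalWeight_le (b d x : ℝ) : |intervalWeight b d x| ≤ 2 := by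
  unfold intervalWeight indicator
  split_ifs <;> simp

/-- Turns the nonlocal mass into a pairing with a fixed bounded function, so that it is continuous
along curves in `L^p`; the sign of the weight covers `d < b`. -/
theorem intervalIntegral_eq_integral_weight {b d : ℝ} (hb : b ∈ Icc (0 : ℝ) 1)
    (hd : d ∈ Icc (0 : ℝ) 1) {f : ℝ → ℝ} (hf : IntegrableOn f (Ioo 0 1)) :
    ∫ z in b..d, f z = ∫ x in Ioo (0 : ℝ) 1, f x * intervalWeight b d x := by
  have key : ∀ b ∈ Icc (0 : ℝ) 1, ∀ d ∈ Icc (0 : ℝ) 1,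
      ∫ z in Ioc b d, f z = ∫ x in Ioo (0 : ℝ) 1, (Ioc b d).indicator f x := by
    intro b hb d hd
    rw [← integral_Ioc_eq_integral_Ioo, setIntegral_indicator measurableSet_Ioc,
      inter_eq_self_of_subset_right (Ioc_subset_Ioc hb.1 hd.2)]
  rw [intervalIntegral, key b hb d hd, key d hd b hb, ← integral_sub
    (hf.indicator measurableSet_Ioc) (hf.indicator measurableSet_Ioc)]
  refine integral_congr_ae (Eventually.of_forall fun x => ?_)
  simp only [intervalWeight, indicator, Pi.one_apply]
  split_ifs <;> simp

theorem continuousOn_intervalIntegral_curve {b d : ℝ} (hb : b ∈ Icc (0 : ℝ) 1)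
    (hd : d ∈ Icc (0 : ℝ) 1) {S : Set ℝ} {ρ : ℝ → LpUnit p} (hρ : ContinuousOn ρ S) :
    ContinuousOn (fun t => ∫ z in b..d, ρ t z) S := by
  simp only [fun t => intervalIntegral_eq_integral_weight hb hd (LpUnit.integrable (ρ t))]
  exact continuousOn_integral_mul hρ (ψ := fun _ => intervalWeight b d)
    (fun _ => measurable_intervalWeight b d) (fun _ _ x _ => abs_intervalWeight_le b d x)
    fun _ _ _ _ => continuousWithinAt_const

/-- Translates of a bounded integrable function form a continuous curve in `L^p((0,1))`. -/
theorem exists_translation_curve (hp : p ≠ ∞) {a b K : ℝ} {g : ℝ → ℝ}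
    (hg : IsBoundedDatum (Ioo a b) K g) {ξ : ℝ → ℝ} (hξ : Continuous ξ) :
    ∃ ρ : ℝ → LpUnit p, Continuous ρ ∧
      ∀ t, ρ t =ᵐ[volume.restrict (Ioo (0 : ℝ) 1)] fun x => g (x - ξ t) := by
  have hgp : MemLp g p volume := by
    refine (memLp_indicator_const p (measurableSet_Ioo (a := a) (b := b)) K
      (Or.inr (by simp))).mono hg.measurable.aestronglyMeasurable (Eventually.of_forall fun x => ?_)
    by_cases hx : x ∈ Ioo a b
    · rw [indicator_of_mem hx, Real.norm_eq_abs, Real.norm_eq_abs]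
      exact (hg.abs_le x).trans (le_abs_self _)
    · simp [hg.eq_zero x hx]
  have hmp : ∀ t, MeasurePreserving (fun x : ℝ => x - ξ t) volume volume :=
    fun t => measurePreserving_sub_right volume (ξ t)
  let s : ℝ → C(ℝ, ℝ) := (ContinuousMap.mk (fun q : ℝ × ℝ => q.2 - ξ q.1)
    (continuous_snd.sub (hξ.comp continuous_fst))).curry
  have hs : Continuous s := ContinuousMap.continuous _
  refine ⟨fun t => LpToLpRestrictCLM ℝ ℝ ℝ volume p (Ioo 0 1)
    (Lp.compMeasurePreserving (s t) (hmp t) (hgp.toLp g)), ?_, fun t => ?_⟩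
  -- Strong continuity of translations is where `p ≠ ∞` enters.
  · exact (LpToLpRestrictCLM ℝ ℝ ℝ volume p (Ioo 0 1)).continuous.comp
      (Continuous.compMeasurePreservingLp continuous_const hs hmp hp)
  · refine (LpToLpRestrictCLM_coeFn ℝ (Ioo 0 1) _).trans (ae_restrict_of_ae ?_)
    refine (Lp.coeFn_compMeasurePreserving _ (hmp t)).trans ?_
    exact (hmp t).quasiMeasurePreserving.ae_eq_comp hgp.coeFn_toLp

end Pairing

/-! ### Linear transport: uniqueness by duality -/

/-- Weak solutions of `∂_t ρ + c(t) ∂_x ρ = 0` for a prescribed speed. -/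
def IsTransportSolution (T : ℝ) {p : ℝ≥0∞} (c ρ₀ u y : ℝ → ℝ) (ρ : ℝ → LpUnit p) : Prop :=
  ∀ φ : ℝ → ℝ → ℝ, ContDiff ℝ 1 (Function.uncurry φ) → (∀ x ∈ Icc (0 : ℝ) 1, φ T x = 0) →
    (∫ t in Ioo 0 T, ∫ x in Ioo (0 : ℝ) 1,
        ρ t x * (deriv (fun τ => φ τ x) t + c t * deriv (fun ξ => φ t ξ) x))
      + (∫ x in Ioo (0 : ℝ) 1, ρ₀ x * φ 0 x)
      + (∫ t in Ioo 0 T, u t * φ t 0)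
      - (∫ t in Ioo 0 T, y t * φ t 1) = 0

theorem isLinkWeakSolution_iff {T : ℝ} {p : ℝ≥0∞} {b d : ℝ} {lam : ℝ → ℝ → ℝ} {ρ₀ u y : ℝ → ℝ}
    {ρ : ℝ → LpUnit p} : IsLinkWeakSolution T b d lam ρ₀ u y ρ ↔
      IsTransportSolution T (fun t => lam t (∫ z in b..d, ρ t z)) ρ₀ u y ρ := Iff.rfl

theorem IsTransportSolution.congr {T : ℝ} {p : ℝ≥0∞} {c c' ρ₀ ρ₀' u u' y y' : ℝ → ℝ}
    {ρ ρ' : ℝ → LpUnit p} (h : IsTransportSolution T c ρ₀ u y ρ)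
    (hρ : ∀ t ∈ Ioo 0 T, ρ t = ρ' t)
    (hc : ∀ t ∈ Ioo 0 T, c t = c' t) (h0 : ρ₀ =ᵐ[volume.restrict (Ioo 0 1)] ρ₀')
    (hu : u =ᵐ[volume.restrict (Ioo 0 T)] u') (hy : y =ᵐ[volume.restrict (Ioo 0 T)] y') :
    IsTransportSolution T c' ρ₀' u' y' ρ' := by
  intro φ hφ hφT
  refine Eq.trans ?_ (h φ hφ hφT)
  symm
  congr 1
  · congr 1
    · congr 1
      · refine setIntegral_congr_fun measurableSet_Ioo fun t ht => ?_
        simp only [hc t ht, hρ t ht]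
      · refine integral_congr_ae ?_
        filter_upwards [h0] with x hx using by rw [hx]
    · refine integral_congr_ae ?_
      filter_upwards [hu] with x hx using by rw [hx]
  · refine integral_congr_ae ?_
    filter_upwards [hy] with x hx using by rw [hx]

section Uniqueness

variable {p : ℝ≥0∞} {m T : ℝ} {c ξ τ : ℝ → ℝ}

/-- Testing a transport solution with a function that is constant along the characteristics
up to a time factor: the contribution of the data to the identity. -/
theorem IsTransportSolution.integral_pairing (h : IsFlow m c ξ τ) {t₀ : ℝ}
    (ht₀ : t₀ ∈ Ioc 0 T) {ρ₀ u y : ℝ → ℝ} {ρ : ℝ → LpUnit p}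
    (hρ : IsTransportSolution T c ρ₀ u y ρ) {a ψ : ℝ → ℝ} (ha : Continuous a)
    (hsa : Function.support a ⊆ Ioo 0 t₀) (hψ : ContDiff ℝ 1 ψ)
    (hsψ : Function.support ψ ⊆ Ioo 0 1) :
    ∫ t in Ioo 0 T, a t * ∫ x in Ioo (0 : ℝ) 1, ρ t x * ψ (x + ξ t₀ - ξ t) =
      - (∫ x in Ioo (0 : ℝ) 1, ρ₀ x * ((∫ s in T..0, a s) * ψ (x + ξ t₀)))
      - ∫ t in Ioo 0 T, u t * ((∫ s in T..t, a s) * ψ (ξ t₀ - ξ t)) := by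
  have hAd : ∀ t, HasDerivAt (fun t => ∫ s in T..t, a s) (a t) t := fun t =>
    intervalIntegral.integral_hasDerivAt_right (ha.intervalIntegrable _ _)
      (ha.stronglyMeasurableAtFilter _ _) ha.continuousAt
  -- The test function is `A t * ψ (x + ξ t₀ - ξ t)`. The transport operator annihilates the second
  -- factor and leaves `A' = a`; based at `T`, the primitive `A` vanishes from `t₀` on.
  set A : ℝ → ℝ := fun t => ∫ s in T..t, a s with hA
  have hAc : ContDiff ℝ 1 A := by
    rw [contDiff_one_iff_deriv]
    refine ⟨fun t => (hAd t).differentiableAt, ?_⟩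
    rwa [show deriv A = a from funext fun t => (hAd t).deriv]
  have hA0 : ∀ t, t₀ ≤ t → A t = 0 := by
    intro t ht
    refine intervalIntegral.integral_zero_ae (Filter.Eventually.of_forall fun s hs => ?_)
    by_contra hne
    have h1 := (hsa hne).2
    rcases mem_uIoc.1 hs with h3 | h3 <;> linarith [ht₀.2, h3.1]
  have hφ : ContDiff ℝ 1 (Function.uncurry fun t x => A t * ψ (x + ξ t₀ - ξ t)) :=
    (hAc.comp contDiff_fst).mul (hψ.comp
      ((contDiff_snd.add contDiff_const).sub (h.contDiff.comp contDiff_fst)))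
  have hid := hρ _ hφ fun x _ => by simp [hA0 T ht₀.2]
  have h1 : ∀ t x, deriv (fun t => A t * ψ (x + ξ t₀ - ξ t)) t =
      a t * ψ (x + ξ t₀ - ξ t) + A t * (deriv ψ (x + ξ t₀ - ξ t) * -c t) := fun t x =>
    ((hAd t).mul (((hψ.differentiable one_ne_zero _).hasDerivAt.comp t
      ((h.hasDerivAt t).const_sub (x + ξ t₀))))).deriv
  have h2 : ∀ t x, deriv (fun x => A t * ψ (x + ξ t₀ - ξ t)) x =
      A t * deriv ψ (x + ξ t₀ - ξ t) := fun t x => by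
    have := ((hψ.differentiable one_ne_zero (x + ξ t₀ - ξ t)).hasDerivAt.comp x
      (((hasDerivAt_id x).add_const (ξ t₀)).sub_const (ξ t))).const_mul (A t)
    simpa using this.deriv
  -- Traced back from `t₀`, the support of `ψ` stays to the left of `x = 1`, so the unknown outflow
  -- drops out.
  have h3 : ∀ t, A t * ψ (1 + ξ t₀ - ξ t) = 0 := fun t => by
    rcases le_total t₀ t with ht | ht
    · rw [hA0 t ht, zero_mul]
    · rw [mul_eq_zero]
      right
      by_contra hne
      linarith [(hsψ hne).2, h.strictMono.monotone ht]
  have h4 : ∀ t x, ρ t x * (deriv (fun t => A t * ψ (x + ξ t₀ - ξ t)) t +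
      c t * deriv (fun x => A t * ψ (x + ξ t₀ - ξ t)) x) =
      a t * (ρ t x * ψ (x + ξ t₀ - ξ t)) := fun t x => by
    rw [h1, h2]; ring
  simp only [h4, h3, integral_const_mul, h.map_zero, mul_zero, integral_zero, sub_zero,
    zero_add] at hid
  linarith

/-- By `integral_pairing`, the pairings with `ψ (x + ξ t₀ - ξ t)` depend only on the data for a.e.
`t` in `(0,t₀)`. Continuity carries this to `t = t₀`, where the shift disappears and `ψ` is
arbitrary; time zero follows by continuity of the curves. -/
theorem IsTransportSolution.unique [Fact (1 ≤ p)] (h : IsFlow m c ξ τ) (hT : 0 < T) {ρ₀ u y₁ y₂ : ℝ → ℝ}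
    {ρ₁ ρ₂ : ℝ → LpUnit p} (hc₁ : ContinuousOn ρ₁ (Icc 0 T)) (hc₂ : ContinuousOn ρ₂ (Icc 0 T))
    (hy₁ : IntegrableOn y₁ (Ioo 0 T)) (hy₂ : IntegrableOn y₂ (Ioo 0 T))
    (h₁ : IsTransportSolution T c ρ₀ u y₁ ρ₁) (h₂ : IsTransportSolution T c ρ₀ u y₂ ρ₂) :
    (∀ t ∈ Icc 0 T, ρ₁ t = ρ₂ t) ∧ y₁ =ᵐ[volume.restrict (Ioo 0 T)] y₂ := by
  have hpos : ∀ t₀ ∈ Ioc 0 T, ρ₁ t₀ = ρ₂ t₀ := by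
    intro t₀ ht₀
    have hψ0 : ∀ ψ : ℝ → ℝ, ContDiff ℝ 1 ψ → HasCompactSupport ψ → tsupport ψ ⊆ Ioo 0 1 →
        ∫ x in Ioo (0 : ℝ) 1, ρ₁ t₀ x * ψ x = ∫ x in Ioo (0 : ℝ) 1, ρ₂ t₀ x * ψ x := by
      intro ψ hψ hψc hsψ
      have hsψ' := (subset_tsupport ψ).trans hsψ
      obtain ⟨C, hC⟩ := hψc.exists_bound_of_continuous hψ.continuous
      have hm : ∀ ρ : ℝ → LpUnit p, ContinuousOn ρ (Icc 0 T) → ContinuousOn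
          (fun t => ∫ x in Ioo (0 : ℝ) 1, ρ t x * ψ (x + ξ t₀ - ξ t)) (Icc 0 T) := fun ρ hρ =>
        continuousOn_integral_mul hρ (ψ := fun t x => ψ (x + ξ t₀ - ξ t))
          (fun t => (hψ.continuous.comp (by fun_prop : Continuous fun x => x + ξ t₀ - ξ t)).measurable)
          (fun t _ x _ => hC _) fun s _ x _ =>
            (hψ.continuous.comp (continuous_const.sub h.continuous)).continuousWithinAt
      have hIcc : Icc 0 t₀ ⊆ Icc 0 T := Icc_subset_Icc_right ht₀.2
      have hIoo : Ioo 0 t₀ ⊆ Icc 0 T := Ioo_subset_Icc_self.trans hIcc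
      have hae := isOpen_Ioo.ae_eq_zero_of_integral_contDiff_smul_eq_zero (U := Ioo 0 t₀)
        (μ := volume)
        ((((hm ρ₁ hc₁).sub (hm ρ₂ hc₂)).mono hIoo).locallyIntegrableOn measurableSet_Ioo)
        fun a ha hac hsa => by
          have hsa' := (subset_tsupport a).trans hsa
          have hi : ∀ ρ : ℝ → LpUnit p, ContinuousOn ρ (Icc 0 T) → IntegrableOn
            (fun t => a t * ∫ x in Ioo (0 : ℝ) 1, ρ t x * ψ (x + ξ t₀ - ξ t)) (Ioo 0 T) :=
            fun ρ hρ => ((ha.continuous.continuousOn.mul (hm ρ hρ)).integrableOn_Icc).mono_set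
              Ioo_subset_Icc_self
          have e₁ := h₁.integral_pairing h ht₀ ha.continuous hsa' hψ hsψ'
          have e₂ := h₂.integral_pairing h ht₀ ha.continuous hsa' hψ hsψ'
          have e := integral_sub (hi ρ₁ hc₁) (hi ρ₂ hc₂)
          rw [e₁, e₂, sub_self] at e
          rw [← setIntegral_eq_integral_of_forall_compl_eq_zero (s := Ioo 0 T)]
          · refine Eq.trans ?_ e
            simp only [smul_eq_mul, Pi.sub_apply, mul_sub]
          · intro t ht
            have : a t = 0 := by
              by_contra hne
              exact ht (Ioo_subset_Ioo_right ht₀.2 (hsa' hne))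
            simp [this]
      have heq := Measure.eqOn_Icc_of_ae_eq volume ht₀.1.ne
        (f := fun t => ∫ x in Ioo (0 : ℝ) 1, ρ₁ t x * ψ (x + ξ t₀ - ξ t))
        (g := fun t => ∫ x in Ioo (0 : ℝ) 1, ρ₂ t x * ψ (x + ξ t₀ - ξ t)) (by
          rw [Filter.EventuallyEq, ← Measure.restrict_congr_set Ioo_ae_eq_Icc,
            ae_restrict_iff' measurableSet_Ioo]
          filter_upwards [hae] with t ht htm
          exact sub_eq_zero.1 (ht htm)) ((hm ρ₁ hc₁).mono hIcc) ((hm ρ₂ hc₂).mono hIcc)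
        (right_mem_Icc.2 ht₀.1.le)
      simpa using heq
    have hae := isOpen_Ioo.ae_eq_zero_of_integral_contDiff_smul_eq_zero (U := Ioo (0 : ℝ) 1)
      (μ := volume) (f := fun x => ρ₁ t₀ x - ρ₂ t₀ x)
      (IntegrableOn.locallyIntegrableOn
        ((LpUnit.integrable (ρ₁ t₀)).sub (LpUnit.integrable (ρ₂ t₀))))
      fun ψ hψ hψc hsψ => by
        obtain ⟨C, hC⟩ := hψc.exists_bound_of_continuous hψ.continuous
        have hi := fun f : LpUnit p => LpUnit.integrable_mul f hψ.continuous.measurable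
          fun x _ => hC x
        have e := integral_sub (hi (ρ₁ t₀)) (hi (ρ₂ t₀))
        rw [hψ0 ψ (hψ.of_le (by simp)) hψc hsψ, sub_self] at e
        rw [← setIntegral_eq_integral_of_forall_compl_eq_zero (s := Ioo (0 : ℝ) 1)]
        · refine Eq.trans ?_ e
          refine integral_congr_ae (Filter.Eventually.of_forall fun x => ?_)
          simp only [smul_eq_mul]
          ring
        · intro x hx
          have : ψ x = 0 := by
            by_contra hne
            exact hx (hsψ (subset_tsupport ψ hne))
          simp [this]
    refine Lp.ext ?_
    rw [Filter.EventuallyEq, ae_restrict_iff' measurableSet_Ioo]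
    filter_upwards [hae] with x hx hxm
    exact sub_eq_zero.1 (hx hxm)
  have hall : EqOn ρ₁ ρ₂ (Icc 0 T) :=
    EqOn.of_subset_closure hpos hc₁ hc₂ Ioc_subset_Icc_self (closure_Ioc hT.ne).ge
  refine ⟨hall, ?_⟩
  -- With equal densities, test functions depending on `t` alone isolate the outflows.
  have hae := isOpen_Ioo.ae_eq_zero_of_integral_contDiff_smul_eq_zero (U := Ioo 0 T)
    (μ := volume) (f := fun t => y₁ t - y₂ t)
    (IntegrableOn.locallyIntegrableOn (hy₁.sub hy₂))
    fun a ha hac hsa => by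
      have hsa' := (subset_tsupport a).trans hsa
      obtain ⟨C, hC⟩ := hac.exists_bound_of_continuous ha.continuous
      have hφ : ContDiff ℝ 1 (Function.uncurry fun t (_ : ℝ) => a t) :=
        (ha.of_le (by simp)).comp contDiff_fst
      have haT : ∀ x ∈ Icc (0 : ℝ) 1, a T = 0 := fun _ _ => by
        by_contra hne
        exact lt_irrefl _ (hsa' hne).2
      have e₁ := h₁ _ hφ haT
      have e₂ := (h₂.congr (fun t ht => (hall (Ioo_subset_Icc_self ht)).symm) (fun _ _ => rfl)
        .rfl .rfl .rfl) _ hφ haT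
      have hi : ∀ y : ℝ → ℝ, IntegrableOn y (Ioo 0 T) →
          IntegrableOn (fun t => y t * a t) (Ioo 0 T) := fun y hy =>
        hy.mul_bdd ha.continuous.aestronglyMeasurable (Filter.Eventually.of_forall hC)
      have e := integral_sub (hi y₁ hy₁) (hi y₂ hy₂)
      rw [show ∫ t in Ioo 0 T, y₁ t * a t = ∫ t in Ioo 0 T, y₂ t * a t by linarith, sub_self] at e
      rw [← setIntegral_eq_integral_of_forall_compl_eq_zero (s := Ioo 0 T)]
      · refine Eq.trans ?_ e
        refine integral_congr_ae (Filter.Eventually.of_forall fun t => ?_)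
        simp only [smul_eq_mul]
        ring
      · intro t ht
        have : a t = 0 := by
          by_contra hne
          exact ht (hsa' hne)
        simp [this]
  rw [Filter.EventuallyEq, ae_restrict_iff' measurableSet_Ioo]
  filter_upwards [hae] with t ht htm
  exact sub_eq_zero.1 (ht htm)

end Uniqueness

/-! ### Contraction and velocity bounds -/

/-- Banach's fixed point theorem for a map on `C([0,T])` that halves distances with respect to an
exponential weight. -/
theorem exists_unique_fixedPoint_of_weighted {T κ : ℝ} (hκ : 0 ≤ κ)
    (Φ : C(Icc (0 : ℝ) T, ℝ) → C(Icc (0 : ℝ) T, ℝ))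
    (hΦ : ∀ f g : C(Icc (0 : ℝ) T, ℝ), ∀ D, 0 ≤ D →
      (∀ s, |f s - g s| ≤ D * Real.exp (κ * s)) →
      ∀ s, |Φ f s - Φ g s| ≤ D / 2 * Real.exp (κ * s)) :
    ∃ f, Φ f = f ∧ ∀ g, Φ g = g → g = f := by
  have hiter : ∀ n : ℕ, ∀ f g s,
      |Φ^[n] f s - Φ^[n] g s| ≤ dist f g / 2 ^ n * Real.exp (κ * s) := by
    intro n f g
    induction n with
    | zero =>
      intro s
      have h1 : |f s - g s| ≤ dist f g := by
        rw [← Real.dist_eq]; exact ContinuousMap.dist_apply_le_dist s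
      have h2 : 1 ≤ Real.exp (κ * s) := Real.one_le_exp (mul_nonneg hκ s.2.1)
      simp only [Function.iterate_zero, id, pow_zero, div_one]
      exact h1.trans (le_mul_of_one_le_right dist_nonneg h2)
    | succ n ih =>
      intro s
      rw [Function.iterate_succ_apply', Function.iterate_succ_apply', pow_succ, ← div_div]
      exact hΦ _ _ _ (by positivity) ih s
  -- Instead of renorming, iterate: the weight costs at most `exp (κ * T)`, which `2 ^ n` eventually
  -- beats, so `Φ^[n]` contracts the sup metric.
  obtain ⟨n, hn⟩ := exists_pow_lt_of_lt_one (Real.exp_pos (-(κ * T))) (by norm_num : (1 / 2 : ℝ) < 1)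
  have hK : Real.exp (κ * T) * (1 / 2) ^ n < 1 := by
    calc _ < Real.exp (κ * T) * Real.exp (-(κ * T)) := by gcongr
      _ = 1 := by rw [← Real.exp_add]; simp
  have hc : ContractingWith ⟨Real.exp (κ * T) * (1 / 2) ^ n, by positivity⟩ Φ^[n] := by
    refine ⟨hK, LipschitzWith.of_dist_le_mul fun f g => ?_⟩
    refine (ContinuousMap.dist_le (mul_nonneg (NNReal.coe_nonneg _) dist_nonneg)).2 fun s => ?_
    rw [Real.dist_eq]
    refine (hiter n f g s).trans ?_
    have : Real.exp (κ * s) ≤ Real.exp (κ * T) :=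
      Real.exp_le_exp.2 (mul_le_mul_of_nonneg_left s.2.2 hκ)
    calc dist f g / 2 ^ n * Real.exp (κ * s) ≤ dist f g / 2 ^ n * Real.exp (κ * T) := by gcongr
      _ = Real.exp (κ * T) * (1 / 2) ^ n * dist f g := by
        rw [one_div, inv_pow]; ring
  have : Nonempty C(Icc (0 : ℝ) T, ℝ) := ⟨0⟩
  exact ⟨_, hc.isFixedPt_fixedPoint_iterate, fun g hg =>
    hc.fixedPoint_unique (Function.IsFixedPt.iterate hg n)⟩

theorem IsVelocity.continuousOn {T : ℝ} {lam : ℝ → ℝ → ℝ} (h : IsVelocity T lam) :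
    ContinuousOn (Function.uncurry lam) (Icc 0 T ×ˢ univ) := h.1.continuousOn

/-- Compactness in `w` is essential: on all of `ℝ` a `C¹` velocity may approach zero or fail to be
Lipschitz. -/
theorem IsVelocity.exists_bounds {T : ℝ} (hT : 0 < T) {lam : ℝ → ℝ → ℝ} (h : IsVelocity T lam)
    {B : ℝ} (hB : 0 ≤ B) :
    ∃ m L, 0 < m ∧ 0 ≤ L ∧ (∀ t ∈ Icc 0 T, ∀ w ∈ Icc (-B) B, m ≤ lam t w) ∧
      ∀ t ∈ Icc 0 T, ∀ w ∈ Icc (-B) B, ∀ w' ∈ Icc (-B) B,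
        |lam t w - lam t w'| ≤ L * |w - w'| := by
  have hcpt : IsCompact (Icc 0 T ×ˢ Icc (-B) B) := isCompact_Icc.prod isCompact_Icc
  have hsub : Icc 0 T ×ˢ Icc (-B) B ⊆ Icc 0 T ×ˢ univ := prod_mono_right (subset_univ _)
  obtain ⟨q, hq, hmin⟩ := hcpt.exists_isMinOn
    ⟨(0, 0), ⟨le_rfl, hT.le⟩, by simpa using hB, hB⟩ (h.continuousOn.mono hsub)
  have hconv : Convex ℝ (Icc 0 T ×ˢ (univ : Set ℝ)) := (convex_Icc 0 T).prod convex_univ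
  have hloc : LocallyLipschitzOn (Icc 0 T ×ˢ Icc (-B) B) (Function.uncurry lam) := by
    intro q hq
    obtain ⟨K, t, ht, hK⟩ := (h.1 q (hsub hq)).exists_lipschitzOnWith hconv
    exact ⟨K, t, nhdsWithin_mono q hsub ht, hK⟩
  obtain ⟨K, hK⟩ := hloc.exists_lipschitzOnWith_of_compact hcpt
  refine ⟨lam q.1 q.2, K, h.2 _ hq.1 _, K.2, fun t ht w hw =>
    isMinOn_iff.1 hmin (t, w) ⟨ht, hw⟩, ?_⟩
  intro t ht w hw w' hw'
  have := hK.dist_le_mul (t, w) ⟨ht, hw⟩ (t, w') ⟨ht, hw'⟩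
  simpa [Prod.dist_eq, Real.dist_eq] using this

theorem IsBoundedDatum.abs_integral_sub_le {I : Set ℝ} {K : ℝ} {f : ℝ → ℝ}
    (hf : IsBoundedDatum I K f) (hi : Integrable f) (a b : ℝ) :
    |(∫ x in (0 : ℝ)..b, f x) - ∫ x in (0 : ℝ)..a, f x| ≤ K * |b - a| := by
  rw [intervalIntegral.integral_interval_sub_left hi.intervalIntegrable hi.intervalIntegrable]
  exact intervalIntegral.norm_integral_le_of_norm_le_const fun x _ =>
    (Real.norm_eq_abs _).trans_le (hf.abs_le x)

/-! ### Dependence of the mass on the flow -/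

section Stability

variable {m T K₁ K₂ : ℝ} {c₁ c₂ ξ₁ ξ₂ τ₁ τ₂ r v : ℝ → ℝ}

theorem IsFlow.of_le {m' : ℝ} {c ξ τ : ℝ → ℝ} (h : IsFlow m c ξ τ) (h0 : 0 < m') (hm : m' ≤ m) :
    IsFlow m' c ξ τ :=
  ⟨h.1, h0, fun t => hm.trans (h.3 t), h.4, h.5, h.6, h.7⟩

/-- A weighted bound on the difference of the speeds gives one on the difference of the flows. -/
theorem IsFlow.abs_sub_le (h₁ : IsFlow m c₁ ξ₁ τ₁) (h₂ : IsFlow m c₂ ξ₂ τ₂) {D κ : ℝ}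
    (hD : 0 ≤ D) (hκ : 0 < κ)
    (hc : ∀ t ∈ Icc 0 T, |c₁ t - c₂ t| ≤ D * Real.exp (κ * t)) :
    ∀ t ∈ Icc 0 T, |ξ₁ t - ξ₂ t| ≤ D / κ * Real.exp (κ * t) := by
  intro t ht
  -- Integrating the exponential weight gains the factor `1 / κ` that later makes the fixed-point
  -- map contract.
  refine image_norm_le_of_norm_deriv_right_le_deriv_boundary (f := fun t => ξ₁ t - ξ₂ t)
    (f' := fun t => c₁ t - c₂ t) (a := 0) (b := T) (B := fun t => D / κ * Real.exp (κ * t))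
    (B' := fun t => D * Real.exp (κ * t))
    (h₁.continuous.sub h₂.continuous).continuousOn
    (fun t _ => ((h₁.hasDerivAt t).sub (h₂.hasDerivAt t)).hasDerivWithinAt) ?_ ?_
    (fun t ht => hc t (Ico_subset_Icc_self ht)) ht
  · simp only [h₁.map_zero, h₂.map_zero, sub_self, norm_zero]
    positivity
  · intro t
    have := (((hasDerivAt_id t).const_mul κ).exp).const_mul (D / κ)
    refine this.congr_deriv ?_
    simp only [id, mul_one]
    field_simp

/-- The amount of mass between the inflow boundary and `x` depends Lipschitz continuously on the
flow. -/
theorem abs_cumulative_sub_cumulative_le (h₁ : IsFlow m c₁ ξ₁ τ₁) (h₂ : IsFlow m c₂ ξ₂ τ₂)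
    (hr : IsBoundedDatum (Ioo 0 1) K₁ r) (hv : IsBoundedDatum (Ioo 0 T) K₂ v) {t E x : ℝ}
    (ht : 0 ≤ t) (hE : ∀ s ∈ Icc 0 t, |ξ₁ s - ξ₂ s| ≤ E) (hx : 0 ≤ x) :
    |cumulative τ₁ r v (x - ξ₁ t) - cumulative τ₂ r v (x - ξ₂ t)| ≤ (K₁ + 2 * K₂ / m) * E := by
  have hm := h₁.lower_pos
  have hE0 : 0 ≤ E := (abs_nonneg _).trans (hE 0 ⟨le_rfl, ht⟩)
  have hU0 : ∀ s ≤ 0, ∫ t in (0 : ℝ)..s, v t = 0 := by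
    intro s hs
    refine intervalIntegral.integral_zero_ae (Filter.Eventually.of_forall fun t ht => ?_)
    refine hv.eq_zero t fun h => ?_
    rw [uIoc_of_ge hs] at ht
    linarith [ht.2, h.1]
  have key : ∀ {c₁ c₂ ξ₁ ξ₂ τ₁ τ₂ : ℝ → ℝ}, IsFlow m c₁ ξ₁ τ₁ → IsFlow m c₂ ξ₂ τ₂ →
      (∀ s ∈ Icc 0 t, |ξ₁ s - ξ₂ s| ≤ E) → τ₂ (ξ₂ t - x) ≤ τ₁ (ξ₁ t - x) →
      |(∫ t in (0 : ℝ)..τ₁ (ξ₁ t - x), v t) - ∫ t in (0 : ℝ)..τ₂ (ξ₂ t - x), v t| ≤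
        2 * K₂ / m * E := by
    intro c₁ c₂ ξ₁ ξ₂ τ₁ τ₂ h₁ h₂ hE hle
    have hnn : 0 ≤ 2 * K₂ / m * E := by have := hv.bound_nonneg; positivity
    rcases le_or_gt (τ₁ (ξ₁ t - x)) 0 with h0 | h0
    · rw [hU0 _ h0, hU0 _ (hle.trans h0)]
      simpa using hnn
    · refine (hv.abs_integral_sub_le hv.integrable _ _).trans ?_
      rw [abs_of_nonneg (sub_nonneg.2 hle)]
      -- Write `σᵢ` for the entry time `τᵢ (ξᵢ t - x)`. Then `m (σ₁ - σ₂) ≤ ξ₂ σ₁ - ξ₂ σ₂ = (ξ₂ -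
      -- ξ₁) σ₁ - (ξ₂ - ξ₁) t ≤ 2 E`, as `σ₁` lies in `[0,t]`; this needs `x ≥ 0` and `σ₁ > 0`.
      have h3 := h₂.mul_sub_le hle
      rw [h₂.right_inv] at h3
      have h4 : τ₁ (ξ₁ t - x) ≤ t := by
        rw [← h₁.strictMono.le_iff_le, h₁.right_inv]; linarith
      have h5 := abs_le.1 (hE _ ⟨h0.le, h4⟩)
      have h6 := abs_le.1 (hE t ⟨ht, le_rfl⟩)
      rw [h₁.right_inv] at h5
      have h7 : τ₁ (ξ₁ t - x) - τ₂ (ξ₂ t - x) ≤ 2 * E / m := by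
        rw [le_div_iff₀ hm]; linarith [h5.1, h6.2]
      calc K₂ * (τ₁ (ξ₁ t - x) - τ₂ (ξ₂ t - x)) ≤ K₂ * (2 * E / m) :=
            mul_le_mul_of_nonneg_left h7 hv.bound_nonneg
        _ = 2 * K₂ / m * E := by ring
  have hU : |(∫ t in (0 : ℝ)..τ₁ (ξ₁ t - x), v t) - ∫ t in (0 : ℝ)..τ₂ (ξ₂ t - x), v t| ≤
        2 * K₂ / m * E := by
    rcases le_total (τ₂ (ξ₂ t - x)) (τ₁ (ξ₁ t - x)) with hle | hle
    · exact key h₁ h₂ hE hle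
    · rw [abs_sub_comm]
      exact key h₂ h₁ (fun s hs => by rw [abs_sub_comm]; exact hE s hs) hle
  have hP := hr.abs_integral_sub_le hr.integrable (x - ξ₂ t) (x - ξ₁ t)
  have hP' : K₁ * |x - ξ₁ t - (x - ξ₂ t)| ≤ K₁ * E := by
    refine mul_le_mul_of_nonneg_left ?_ hr.bound_nonneg
    rw [show x - ξ₁ t - (x - ξ₂ t) = -(ξ₁ t - ξ₂ t) by ring, abs_neg]
    exact hE t ⟨ht, le_rfl⟩
  unfold cumulative
  rw [neg_sub, neg_sub]
  have h8 := abs_le.1 hU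
  have h9 := abs_le.1 (hP.trans hP')
  rw [abs_le]
  constructor <;> linarith [h8.1, h8.2, h9.1, h9.2]

theorem continuous_cumulative {c ξ τ : ℝ → ℝ} (h : IsFlow m c ξ τ)
    (hr : IsBoundedDatum (Ioo 0 1) K₁ r) (hv : IsBoundedDatum (Ioo 0 T) K₂ v) :
    Continuous (cumulative τ r v) :=
  (intervalIntegral.continuous_primitive (fun _ _ => hr.integrable.intervalIntegrable) 0).sub
    ((intervalIntegral.continuous_primitive (fun _ _ => hv.integrable.intervalIntegrable) 0).comp
      (h.inv_continuous.comp continuous_neg))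

end Stability

/-! ### The self-consistent speed -/

section SelfConsistent

variable {T K₁ K₂ b d : ℝ} {r v : ℝ → ℝ} {lam : ℝ → ℝ → ℝ}

/-- The mass between `b` and `d` at time `t`. -/
noncomputable def nonlocalMass (b d : ℝ) (ξ τ r v : ℝ → ℝ) (t : ℝ) : ℝ :=
  cumulative τ r v (d - ξ t) - cumulative τ r v (b - ξ t)

/-- There is exactly one speed that is consistent with the nonlocal mass it produces. -/
theorem exists_unique_selfConsistent_flow (hT : 0 < T) (hb : b ∈ Icc (0 : ℝ) 1)
    (hd : d ∈ Icc (0 : ℝ) 1) (hlam : IsVelocity T lam)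
    (hr : IsBoundedDatum (Ioo 0 1) K₁ r) (hv : IsBoundedDatum (Ioo 0 T) K₂ v) :
    ∃ m c ξ τ, IsFlow m c ξ τ ∧ (∀ t ∈ Icc 0 T, c t = lam t (nonlocalMass b d ξ τ r v t)) ∧
      ∀ m' c' ξ' τ', IsFlow m' c' ξ' τ' →
        (∀ t ∈ Icc 0 T, c' t = lam t (nonlocalMass b d ξ' τ' r v t)) →
        ∀ t ∈ Icc 0 T, c' t = c t := by
  set B : ℝ := (∫ x, r x) + ∫ t, v t with hB
  have hB0 : 0 ≤ B := add_nonneg (integral_nonneg hr.nonneg) (integral_nonneg hv.nonneg)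
  have hBB : -B ≤ B := by linarith
  have hmass : ∀ ξ τ t, nonlocalMass b d ξ τ r v t ∈ Icc (-B) B := fun ξ τ t =>
    abs_le.1 (abs_cumulative_sub_le hr hv _ _)
  obtain ⟨m, L, hm, hL, hmlam, hLlam⟩ := hlam.exists_bounds hT hB0
  -- Projecting time to `[0,T]` and mass to `[-B,B]` gives a speed on all of `ℝ` with uniform
  -- bounds. The truncation is inactive at the masses that occur, by `hmass`.
  let speed : C(Icc (0 : ℝ) T, ℝ) → ℝ → ℝ := fun W t =>
    lam (projIcc 0 T hT.le t) (projIcc (-B) B hBB (W (projIcc 0 T hT.le t)))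
  have hspeed_cont : ∀ W, Continuous (speed W) := fun W =>
    hlam.continuousOn.comp_continuous
      (f := fun t => ((projIcc 0 T hT.le t : ℝ), (projIcc (-B) B hBB (W (projIcc 0 T hT.le t)) : ℝ)))
      (by fun_prop) fun t => ⟨Subtype.coe_prop _, mem_univ _⟩
  have hspeed_le : ∀ W t, m ≤ speed W t := fun W t =>
    hmlam _ (Subtype.coe_prop _) _ (Subtype.coe_prop _)
  have hspeed_sub : ∀ (W W' : C(Icc (0 : ℝ) T, ℝ)) (t : Icc (0 : ℝ) T),
      |speed W t - speed W' t| ≤ L * |W t - W' t| := fun W W' t => by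
    simp only [speed, projIcc_val]
    refine (hLlam _ t.2 _ (Subtype.coe_prop _) _ (Subtype.coe_prop _)).trans ?_
    exact mul_le_mul_of_nonneg_left (abs_projIcc_sub_projIcc hBB) hL
  choose ξ τ hflow using fun W => exists_isFlow (hspeed_cont W) hm (hspeed_le W)
  have hcont : ∀ {m c ξ τ}, IsFlow m c ξ τ → Continuous (nonlocalMass b d ξ τ r v) := fun h =>
    ((continuous_cumulative h hr hv).comp (continuous_const.sub h.continuous)).sub
      ((continuous_cumulative h hr hv).comp (continuous_const.sub h.continuous))
  have hstab : ∀ {m c₁ ξ₁ τ₁ c₂ ξ₂ τ₂}, IsFlow m c₁ ξ₁ τ₁ → IsFlow m c₂ ξ₂ τ₂ → ∀ {D κ : ℝ},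
      0 ≤ D → 0 < κ → (∀ t ∈ Icc 0 T, |c₁ t - c₂ t| ≤ D * Real.exp (κ * t)) → ∀ t ∈ Icc 0 T,
      |nonlocalMass b d ξ₁ τ₁ r v t - nonlocalMass b d ξ₂ τ₂ r v t| ≤
        2 * (K₁ + 2 * K₂ / m) * (D / κ * Real.exp (κ * t)) := by
    intro m c₁ ξ₁ τ₁ c₂ ξ₂ τ₂ h₁ h₂ D κ hD hκ hc t ht
    have hE : ∀ s ∈ Icc 0 t, |ξ₁ s - ξ₂ s| ≤ D / κ * Real.exp (κ * t) := fun s hs => by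
      refine (h₁.abs_sub_le h₂ hD hκ hc s ⟨hs.1, hs.2.trans ht.2⟩).trans ?_
      have := hs.2
      gcongr
    have e₁ := abs_le.1 (abs_cumulative_sub_cumulative_le h₁ h₂ hr hv ht.1 hE hd.1)
    have e₂ := abs_le.1 (abs_cumulative_sub_cumulative_le h₁ h₂ hr hv ht.1 hE hb.1)
    unfold nonlocalMass
    rw [abs_le]
    constructor <;> linarith [e₁.1, e₁.2, e₂.1, e₂.2]
  let Φ : C(Icc (0 : ℝ) T, ℝ) → C(Icc (0 : ℝ) T, ℝ) := fun W =>
    ⟨fun t => nonlocalMass b d (ξ W) (τ W) r v t, (hcont (hflow W)).comp continuous_subtype_val⟩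
  set A : ℝ := K₁ + 2 * K₂ / m with hA
  have hA0 : 0 ≤ A := by
    have h1 := hr.bound_nonneg
    have h2 := hv.bound_nonneg
    positivity
  -- The map has weighted Lipschitz constant `2 * A * L / κ`, which must not exceed `1 / 2`; the
  -- added `1` keeps the weight positive if `A * L = 0`.
  have hκ : 0 < 4 * A * L + 1 := by positivity
  obtain ⟨W, hW, huniq⟩ := exists_unique_fixedPoint_of_weighted hκ.le Φ (by
    intro f g D hD hfg s
    have := hstab (hflow f) (hflow g) (mul_nonneg hL hD) hκ (fun t ht => by
      refine (hspeed_sub f g ⟨t, ht⟩).trans ?_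
      rw [mul_assoc]
      exact mul_le_mul_of_nonneg_left (hfg ⟨t, ht⟩) hL) s s.2
    refine this.trans ?_
    rw [← mul_assoc]
    refine mul_le_mul_of_nonneg_right ?_ (Real.exp_pos _).le
    rw [← mul_div_assoc, div_le_iff₀ hκ]
    nlinarith [mul_nonneg hA0 (mul_nonneg hL hD)])
  have hspeed_eq : ∀ (W : C(Icc (0 : ℝ) T, ℝ)) (t : Icc (0 : ℝ) T), W t ∈ Icc (-B) B →
      speed W t = lam t (W t) := fun W t h => by
    simp only [speed, projIcc_val, projIcc_of_mem hBB h]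
  have hWt : ∀ t : Icc (0 : ℝ) T, nonlocalMass b d (ξ W) (τ W) r v t = W t := fun t =>
    congrArg (fun f : C(Icc (0 : ℝ) T, ℝ) => f t) hW
  refine ⟨m, speed W, ξ W, τ W, hflow W, fun t ht => ?_, ?_⟩
  · rw [hWt ⟨t, ht⟩]
    exact hspeed_eq W ⟨t, ht⟩ (by rw [← hWt]; exact hmass _ _ _)
  · intro m' c' ξ' τ' h' hc' t ht
    let W' : C(Icc (0 : ℝ) T, ℝ) :=
      ⟨fun t => nonlocalMass b d ξ' τ' r v t, (hcont h').comp continuous_subtype_val⟩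
    have hc'' : ∀ t ∈ Icc 0 T, c' t = speed W' t := fun t ht => by
      rw [hc' t ht]; exact (hspeed_eq W' ⟨t, ht⟩ (hmass _ _ _)).symm
    -- On `[0,T]` the competitor has the truncated speed of its own mass, so stability with `D = 0`
    -- makes the two masses equal. The lower bounds `m` and `m'` may differ, hence their minimum.
    have hfix : Φ W' = W' := by
      ext s
      have h0 : 0 < min m m' := lt_min hm h'.lower_pos
      have := hstab ((hflow W').of_le h0 (min_le_left _ _)) (h'.of_le h0 (min_le_right _ _))
        le_rfl one_pos (fun t ht => by simp [hc'' t ht]) s s.2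
      rw [zero_div, zero_mul, mul_zero] at this
      exact sub_eq_zero.1 (abs_nonpos_iff.1 this)
    rw [hc'' t ht, huniq W' hfix]

end SelfConsistent

/-! ### Existence and uniqueness on one link -/

section Link

variable {p : ℝ≥0∞} [Fact (1 ≤ p)] {m T K₁ K₂ b d : ℝ} {c ξ τ r v ρ₀ u : ℝ → ℝ}
  {lam : ℝ → ℝ → ℝ}

/-- The translates of the profile do everything at once: they inherit its sign and bound, their mass
is a difference of its primitive, and their trace at `x = 1` times the speed is the outflow. -/
theorem exists_transportSolution (hp : p ≠ ∞) (h : IsFlow m c ξ τ) (hT : 0 < T)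
    (hr : IsBoundedDatum (Ioo 0 1) K₁ r) (hv : IsBoundedDatum (Ioo 0 T) K₂ v) :
    ∃ (ρ : ℝ → LpUnit p) (y : ℝ → ℝ), InSolutionSpace T p ρ ∧
      (∀ t, ∀ᵐ x ∂volume.restrict (Ioo (0 : ℝ) 1), 0 ≤ ρ t x) ∧
      (∀ t, ∀ b ∈ Icc (0 : ℝ) 1, ∀ d ∈ Icc (0 : ℝ) 1,
        ∫ z in b..d, ρ t z = nonlocalMass b d ξ τ r v t) ∧
      IsLinftyNonneg (Ioo 0 T) y ∧ IsTransportSolution T c r v y ρ := by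
  have hg := isBoundedDatum_profile h hT hr hv
  obtain ⟨ρ, hρc, hρ⟩ := exists_translation_curve hp hg h.continuous
  refine ⟨ρ, fun t => c t * profile c τ r v (1 - ξ t),
    ⟨hρc.continuousOn, K₁ + K₂ / m, Filter.Eventually.of_forall fun t => ?_⟩,
    fun t => ?_, fun t b hb d hd => ?_, ⟨?_, ?_⟩, ?_⟩
  · filter_upwards [hρ t] with x hx
    rw [hx]
    exact hg.abs_le _
  · filter_upwards [hρ t] with x hx
    rw [hx]
    exact hg.nonneg _
  · have hgi : IntegrableOn (fun x => profile c τ r v (x - ξ t)) (Ioo 0 1) :=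
      (hg.integrable.comp_sub_right (ξ t)).integrableOn
    calc ∫ z in b..d, ρ t z = ∫ z in b..d, profile c τ r v (z - ξ t) := by
          rw [intervalIntegral_eq_integral_weight hb hd (LpUnit.integrable (ρ t)),
            intervalIntegral_eq_integral_weight hb hd hgi]
          refine integral_congr_ae ?_
          filter_upwards [hρ t] with x hx using by rw [hx]
      _ = _ := by
          rw [intervalIntegral.integral_comp_sub_right (fun z => profile c τ r v z),
            integral_profile h hr hv]
          rfl
  · obtain ⟨C, hC⟩ := isCompact_Icc.exists_bound_of_continuousOn
      (h.speed_continuous.continuousOn (s := Icc 0 T))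
    refine memLp_top_of_bound (h.speed_continuous.measurable.mul (hg.measurable.comp
      (h.continuous.measurable.const_sub 1))).aestronglyMeasurable (C * (K₁ + K₂ / m)) ?_
    filter_upwards [ae_restrict_mem measurableSet_Ioo] with t ht
    have h1 := hC t (Ioo_subset_Icc_self ht)
    rw [norm_mul]
    exact mul_le_mul h1 (hg.abs_le _) (norm_nonneg _) ((norm_nonneg _).trans h1)
  · exact Filter.Eventually.of_forall fun t => mul_nonneg (h.speed_pos t).le (hg.nonneg _)
  · intro φ hφ hφT
    refine Eq.trans ?_ (linear_weak_identity h hT hr hv hφ hφT)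
    congr 3
    refine setIntegral_congr_fun measurableSet_Ioo fun t _ => integral_congr_ae ?_
    filter_upwards [hρ t] with x hx using by rw [hx]

theorem IsLinftyNonneg.integrableOn {a b : ℝ} {f : ℝ → ℝ} (h : IsLinftyNonneg (Ioo a b) f) :
    IntegrableOn f (Ioo a b) := h.1.integrable le_top

/-- Existence and uniqueness on a single link with a prescribed bounded nonnegative inflow. -/
theorem exists_unique_link_solution (hT : 0 < T) (hp : p ≠ ∞) (hb : b ∈ Icc (0 : ℝ) 1)
    (hd : d ∈ Icc (0 : ℝ) 1) (hlam : IsVelocity T lam) (hρ₀ : IsLinftyNonneg (Ioo 0 1) ρ₀)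
    (hu : IsLinftyNonneg (Ioo 0 T) u) :
    ∃ (ρ : ℝ → LpUnit p) (y : ℝ → ℝ), InSolutionSpace T p ρ ∧ IsLinftyNonneg (Ioo 0 T) y ∧
      IsLinkWeakSolution T b d lam ρ₀ u y ρ ∧
      (∀ t, ∀ᵐ x ∂volume.restrict (Ioo (0 : ℝ) 1), 0 ≤ ρ t x) ∧
      ∀ (ρ' : ℝ → LpUnit p) (u' y' : ℝ → ℝ), InSolutionSpace T p ρ' →
        u' =ᵐ[volume.restrict (Ioo 0 T)] u → IntegrableOn y' (Ioo 0 T) →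
        IsLinkWeakSolution T b d lam ρ₀ u' y' ρ' →
        (∀ t ∈ Icc 0 T, ρ' t = ρ t) ∧ y' =ᵐ[volume.restrict (Ioo 0 T)] y := by
  obtain ⟨K₁, r, hr, hrρ⟩ := hρ₀.exists_isBoundedDatum measurableSet_Ioo
  obtain ⟨K₂, v, hv, hvu⟩ := hu.exists_isBoundedDatum measurableSet_Ioo
  obtain ⟨m, c, ξ, τ, h, hc, huniq⟩ := exists_unique_selfConsistent_flow hT hb hd hlam hr hv
  obtain ⟨ρ, y, hρs, hρ0, hmass, hy, hsol⟩ := exists_transportSolution hp h hT hr hv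
  refine ⟨ρ, y, hρs, hy, ?_, hρ0, ?_⟩
  · exact hsol.congr (fun _ _ => rfl)
      (fun t ht => by rw [hmass t b hb d hd]; exact hc t (Ioo_subset_Icc_self ht)) hrρ hvu .rfl
  · intro ρ' u' y' hρ' hu' hy' hsol'
    rw [isLinkWeakSolution_iff] at hsol'
    have hWc : ContinuousOn (fun t => lam t (∫ z in b..d, ρ' t z)) (Icc 0 T) :=
      hlam.continuousOn.comp (continuousOn_id.prodMk
        (continuousOn_intervalIntegral_curve hb hd hρ'.1)) fun t ht => ⟨ht, mem_univ _⟩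
    -- The competitor's own speed, extended by constants; its minimum on `[0,T]` is a positive lower
    -- bound everywhere, so it generates a flow.
    set c' : ℝ → ℝ := IccExtend hT.le ((Icc 0 T).domRestrict fun t => lam t (∫ z in b..d, ρ' t z))
      with hc'
    have hc't : ∀ t ∈ Icc 0 T, c' t = lam t (∫ z in b..d, ρ' t z) := fun t ht => by
      rw [hc', IccExtend_of_mem _ _ ht, domRestrict_apply]
    have hc'c : Continuous c' := (continuousOn_iff_continuous_domRestrict.1 hWc).Icc_extend'
    obtain ⟨t₁, ht₁, hmin⟩ := isCompact_Icc.exists_isMinOn (nonempty_Icc.2 hT.le) hWc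
    have hmin' : ∀ t, lam t₁ (∫ z in b..d, ρ' t₁ z) ≤ c' t := fun t =>
      isMinOn_iff.1 hmin _ (projIcc 0 T hT.le t).2
    obtain ⟨ξ', τ', h'⟩ := exists_isFlow hc'c (hlam.2 t₁ ht₁ _) hmin'
    obtain ⟨ρ'', y'', hρ''s, -, hmass'', hy'', hsol''⟩ := exists_transportSolution hp h' hT hr hv
    have hsol₁ : IsTransportSolution T c' r v y' ρ' := hsol'.congr (fun _ _ => rfl)
      (fun t ht => (hc't t (Ioo_subset_Icc_self ht)).symm) hrρ.symm (hu'.trans hvu.symm) .rfl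
    -- The competitor is the travelling profile of its own speed. Its mass is then given by
    -- `nonlocalMass`, so that speed is self-consistent and must be `c`.
    have heq := (hsol₁.unique h' hT hρ'.1 hρ''s.1 hy' hy''.integrableOn hsol'').1
    have hcc : ∀ t ∈ Icc 0 T, c' t = c t := huniq _ c' ξ' τ' h' fun t ht => by
      rw [hc't t ht, heq t ht, hmass'' t b hb d hd]
    have hsol₂ : IsTransportSolution T c r v y' ρ' := hsol₁.congr (fun _ _ => rfl)
      (fun t ht => hcc t (Ioo_subset_Icc_self ht)) .rfl .rfl .rfl
    exact hsol₂.unique h hT hρ'.1 hρs.1 hy' hy.integrableOn hsol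

end Link

/-! ### Propagation through the acyclic network -/

section LinftyNonneg

variable {I : Set ℝ} {f g : ℝ → ℝ}

theorem IsLinftyNonneg.add (hf : IsLinftyNonneg I f) (hg : IsLinftyNonneg I g) :
    IsLinftyNonneg I fun x => f x + g x :=
  ⟨hf.1.add hg.1, by filter_upwards [hf.2, hg.2] with x h1 h2 using add_nonneg h1 h2⟩

theorem IsLinftyNonneg.mul (hf : IsLinftyNonneg I f) (hg : IsLinftyNonneg I g) :
    IsLinftyNonneg I fun x => f x * g x :=
  ⟨hg.1.mul hf.1, by filter_upwards [hf.2, hg.2] with x h1 h2 using mul_nonneg h1 h2⟩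

theorem IsLinftyNonneg.sum {ι : Type*} (s : Finset ι) {f : ι → ℝ → ℝ}
    (hf : ∀ i ∈ s, IsLinftyNonneg I (f i)) : IsLinftyNonneg I fun x => ∑ i ∈ s, f i x := by
  classical
  induction s using Finset.induction_on with
  | empty => exact ⟨by simp, by simp⟩
  | insert i s hi ih =>
    simp only [Finset.sum_insert hi]
    exact (hf i (Finset.mem_insert_self i s)).add
      (ih fun j hj => hf j (Finset.mem_insert_of_mem hj))

end LinftyNonneg

namespace Network

/-- In an acyclic network, the relation "ends where the other link originates" is well-founded. -/
theorem Acyclic.wellFounded {N : Network} (hN : N.Acyclic) :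
    WellFounded fun a' a : N.Link => target a' = origin a := by
  have htrans : ∀ a' a : N.Link, Relation.TransGen (fun a' a : N.Link => target a' = origin a) a' a →
      Relation.TransGen (fun i j => (i, j) ∈ N.links) (origin a') (origin a) := by
    intro a' a h
    have hstep : ∀ a' a : N.Link, target a' = origin a → (origin a', origin a) ∈ N.links :=
      fun a' a h => by rw [← h]; exact a'.2
    exact h.lift origin hstep
  have : Std.Irrefl (Relation.TransGen fun a' a : N.Link => target a' = origin a) :=
    ⟨fun a ha => hN _ (htrans a a ha)⟩
  -- Passing to the transitive closure gives a strict order, and strict orders on a finite type are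
  -- well-founded.
  have hwf := Finite.wellFounded_of_trans_of_irrefl
    (Relation.TransGen fun a' a : N.Link => target a' = origin a)
  have hsub : Subrelation (fun a' a : N.Link => target a' = origin a)
      (Relation.TransGen fun a' a : N.Link => target a' = origin a) :=
    fun h => Relation.TransGen.single h
  exact hsub.wf hwf

end Network

theorem mainTheorem1 (N : Network) (hN : N.Acyclic)
    (T : ℝ) (hT : 0 < T) (p : ℝ≥0∞) [Fact (1 ≤ p)] (hp : p ≠ ∞)
    (b d : ℝ) (hb : b ∈ Icc (0 : ℝ) 1) (hd : d ∈ Icc (0 : ℝ) 1)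
    (lam : N.Link → ℝ → ℝ → ℝ) (hlam : ∀ a, IsVelocity T (lam a))
    (ρ₀ : N.Link → ℝ → ℝ) (hρ₀ : ∀ a, IsLinftyNonneg (Ioo 0 1) (ρ₀ a))
    (θ : N.Link → ℝ → ℝ) (hθ : IsSplit N T θ)
    (s : N.Link → ℝ → ℝ) (hs : IsSource N T s) :
    ∃ (ρ : N.Link → ℝ → LpUnit p) (u y : N.Link → ℝ → ℝ),
      IsNetworkWeakSolution N T p b d lam ρ₀ θ s ρ u y ∧
      (∀ a, (∀ t ∈ Icc 0 T, ∀ᵐ x ∂volume.restrict (Ioo (0 : ℝ) 1), 0 ≤ ρ a t x) ∧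
        (∀ᵐ t ∂volume.restrict (Ioo 0 T), 0 ≤ u a t) ∧
        (∀ᵐ t ∂volume.restrict (Ioo 0 T), 0 ≤ y a t)) ∧
      ∀ (ρ' : N.Link → ℝ → LpUnit p) (u' y' : N.Link → ℝ → ℝ),
        IsNetworkWeakSolution N T p b d lam ρ₀ θ s ρ' u' y' →
        ∀ a, (∀ t ∈ Icc 0 T, ρ' a t = ρ a t) ∧
          u' a =ᵐ[volume.restrict (Ioo 0 T)] u a ∧
          y' a =ᵐ[volume.restrict (Ioo 0 T)] y a := by
  have hwf := hN.wellFounded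
  -- The solution operators are total in `u`, with arbitrary values at inadmissible inflows.
  -- Outflows can thus be defined by recursion first and shown admissible afterwards.
  choose! R Y hspace hY hweak hnonneg huniq using fun (a : N.Link) (u : ℝ → ℝ)
    (hu : IsLinftyNonneg (Ioo 0 T) u) =>
      exists_unique_link_solution (p := p) hT hp hb hd (hlam a) (hρ₀ a) hu
  have horigin : ∀ a : N.Link, Network.origin a ∈ N.nodes := fun a =>
    (Finset.mem_product.1 (N.links_subset a.2)).1
  -- the outflows, link by link in the direction of the flow
  let F : (a : N.Link) → ((a' : N.Link) → Network.target a' = Network.origin a → ℝ → ℝ) →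
      ℝ → ℝ := fun a y => Y a fun t => s a t + θ a t *
        ∑ a' ∈ (N.inLinks (Network.origin a)).attach, y a'.1 (Finset.mem_filter.1 a'.2).2 t
  let y : N.Link → ℝ → ℝ := hwf.fix F
  let u : N.Link → ℝ → ℝ := fun a t =>
    s a t + θ a t * ∑ a' ∈ N.inLinks (Network.origin a), y a' t
  have hyu : ∀ a, y a = Y a (u a) := fun a => by
    have h1 : y a = F a fun a' _ => y a' := hwf.fix_eq F a
    rw [h1]
    refine congrArg (Y a) (funext fun t => ?_)
    simp only [u]
    rw [Finset.sum_attach (N.inLinks (Network.origin a)) fun a' => y a' t]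
  have hmem : ∀ {a a' : N.Link}, a' ∈ N.inLinks (Network.origin a) →
      Network.target a' = Network.origin a := fun h => (Finset.mem_filter.1 h).2
  have hyn : ∀ a, IsLinftyNonneg (Ioo 0 T) (y a) := fun a => by
    induction a using hwf.induction with
    | _ a ih =>
      rw [hyu]
      exact hY a _ ((hs a).add ((hθ.1 a).mul (IsLinftyNonneg.sum _ fun a' ha' => ih a' (hmem ha'))))
  have hun : ∀ a, IsLinftyNonneg (Ioo 0 T) (u a) := fun a =>
    (hs a).add ((hθ.1 a).mul (IsLinftyNonneg.sum _ fun a' _ => hyn a'))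
  refine ⟨fun a => R a (u a), u, y, ⟨fun a => hspace a _ (hun a),
    fun a => (hun a).integrableOn, fun a => (hyn a).integrableOn, fun a => ?_, ?_⟩,
    fun a => ⟨fun t _ => hnonneg a _ (hun a) t, (hun a).2, (hyn a).2⟩, ?_⟩
  · rw [hyu]
    exact hweak a _ (hun a)
  · intro v _ a ha
    have hv : Network.origin a = v := (Finset.mem_filter.1 ha).2
    subst hv
    exact Filter.Eventually.of_forall fun t => rfl
  · intro ρ' u' y' h a
    -- Agreement of all upstream outflows forces agreement of the inflow through the node condition,
    -- and the link result does the rest.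
    induction a using hwf.induction with
    | _ a ih =>
      have hu : u' a =ᵐ[volume.restrict (Ioo 0 T)] u a := by
        have h1 := h.node _ (horigin a) a (Finset.mem_filter.2 ⟨Finset.mem_univ _, rfl⟩)
        have h2 : ∀ᵐ t ∂volume.restrict (Ioo 0 T), ∀ a' ∈ N.inLinks (Network.origin a),
            y' a' t = y a' t :=
          (Filter.eventually_all_finset _).2 fun a' ha' => (ih a' (hmem ha')).2.2
        filter_upwards [h1, h2] with t h1 h2
        rw [← h1, Finset.sum_congr rfl h2]
      obtain ⟨h1, h2⟩ := huniq a (u a) (hun a) (ρ' a) (u' a) (y' a) (h.mem_space a) hu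
        (h.outflow_integrable a) (h.weak a)
      exact ⟨h1, hu, by rw [hyu]; exact h2⟩
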